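/- Let $d\ge 1$. For a unitary $d\times d$ matrix $U$ let $\mathcal P_U$ be the von Neumann measurement on $\mathbb C^d$ in the orthonormal basis $U|1\rangle,\dots,U|d\rangle$, regarded as the channel $\mathcal P_U(\sigma)=\sum_{i=1}^d\langle i|U^\dagger\sigma U|i\rangle\,|i\rangle\langle i|$; in particular $\mathcal P_{1\!\mathrm l}$ is the measurement in the computational basis. For unitaries $U_1,U_2$ let $p_u^e(\mathcal P_{U_1},\mathcal P_{U_2})$ be the optimal entanglement-assisted unambiguous discrimination probability, i.e. the supremum of $$\tfrac12\Big(\operatorname{tr}\big(M_1(\mathcal P_{U_1}\otimes\mathrm{id})(\sigma)\big)+\operatorname{tr}\big(M_2(\mathcal P_{U_2}\otimes\mathrm{id})(\sigma)\big)\Big)$$ over all ancilla dimensions $d'$, all states $\sigma$ on $\mathbb C^d\otimes\mathbb C^{d'}$ and all three-outcome POVMs $(M_1,M_2,M_?)$ on $\mathbb C^d\otimes\mathbb C^{d'}$ with $\operatorname{tr}(M_2(\mathcal P_{U_1}\otimes\mathrm{id})(\sigma))=\operatorname{tr}(M_1(\mathcal P_{U_2}\otimes\mathrm{id})(\sigma))=0$.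 Let $\|S\|_\diamond=\sup\|(S\otimes\mathrm{id}_{k})(X)\|_1$ over all $k$ and all $X$ on $\mathbb C^d\otimes\mathbb C^{k}$ with $\|X\|_1=1$. Then the following hold. (a) For all unitaries $U_1,U_2$ both suprema are attained (for $p_u^e(\mathcal P_{U_1},\mathcal P_{U_2})$ and for $\|\mathcal P_{U_1}-\mathcal P_{U_2}\|_\diamond$), $\|\mathcal P_{U_1}-\mathcal P_{U_2}\|_\diamond\le 2$, and $$p_u^e(\mathcal P_{U_1},\mathcal P_{U_2})=1-\sqrt{1-\tfrac14\|\mathcal P_{U_1}-\mathcal P_{U_2}\|_\diamond^2}.$$ (b) For every unitary $U$, $$p_u^e(\mathcal P_{1\!\mathrm l},\mathcal P_U)=1-\min_{\rho}\sum_{i=1}^d|\langle i|\rho U|i\rangle|,$$ where the minimum is over all density matrices $\rho$ on $\mathbb C^d$ and is attained. (c) Let $U$ be unitary and let $|\psi\rangle\in\mathbb C^d\otimes\mathbb C^{k}$ be a unit vector. Put $|a_i\rangle=(\langle i|\otimes 1)|\psi\rangle$ and $|b_i\rangle=(\langle i|U^\dagger\otimes 1)|\psi\rangle$. These are the unnormalized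 pure states left on the ancilla after the label $i$: $(\mathcal P_{1\!\mathrm l}\otimes\mathrm{id})(|\psi\rangle\langle\psi|)=\sum_i|i\rangle\langle i|\otimes|a_i\rangle\langle a_i|$ and $(\mathcal P_{U}\otimes\mathrm{id})(|\psi\rangle\langle\psi|)=\sum_i|i\rangle\langle i|\otimes|b_i\rangle\langle b_i|$. For each $i$ there is a POVM $T^{(i)}=(T^{(i)}_1,T^{(i)}_2,T^{(i)}_?)$ on the ancilla that maximizes $\frac12(\langle a_i|T_1|a_i\rangle+\langle b_i|T_2|b_i\rangle)$ among the POVMs with $\langle a_i|T_2|a_i\rangle=\langle b_i|T_1|b_i\rangle=0$, i.e. discriminates $|a_i\rangle$ and $|b_i\rangle$ unambiguously in the optimal way. For any such choice the measurement with effects $\sum_i|i\rangle\langle i|\otimes T^{(i)}_x$, $x\in\{1,2,?\}$ (read the label, then discriminate the pure states on the ancilla), satisfies the unambiguity condition and has the largest success probability among all unambiguous measurements for the input $|\psi\rangle$. Moreover, there are a unit vector $|\psi\rangle\in\mathbb C^d\otimes\mathbb C^d$ and such optimal $T^{(i)}$ for which this scheme attains $p_u^e(\mathcal P_{1\!\mathrm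 l},\mathcal P_U)$. -/

import Mathlib

open scoped Matrix Kronecker ComplexOrder

noncomputable section

/-- The trace norm `‖A‖₁ = tr √(A†A)`: the sum of the singular values of `A`. -/
def traceNorm {n : Type*} [Fintype n] [DecidableEq n] (A : Matrix n n ℂ) : ℝ :=
  ∑ i, Real.sqrt ((Matrix.isHermitian_conjTranspose_mul_self A).eigenvalues i)

/-- Density matrices (quantum states). -/
def IsDensity {n : Type*} [Fintype n] (σ : Matrix n n ℂ) : Prop :=
  σ.PosSemidef ∧ σ.trace = 1

/-- The rank-one operator `|ψ⟩⟨ψ|`; it is a pure state when `ψ` is a unit vector. -/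
def ketbra {n : Type*} (ψ : n → ℂ) : Matrix n n ℂ :=
  Matrix.vecMulVec ψ (star ψ)

/-- `M` is a generalized measurement with finitely many outcomes. -/
def IsPOVM {o n : Type*} [Fintype o] [Fintype n] [DecidableEq n] (M : o → Matrix n n ℂ) : Prop :=
  (∀ i, (M i).PosSemidef) ∧ ∑ i, M i = 1

/-- The measure-and-prepare channel `σ ↦ ∑ i, tr (M i σ) |i⟩⟨i|` of a measurement `M`. -/
def measChannel {o n : Type*} [Fintype o] [DecidableEq o] [Fintype n]
    (M : o → Matrix n n ℂ) : Matrix n n ℂ →ₗ[ℂ] Matrix o o ℂ where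
  toFun σ := ∑ i, (M i * σ).trace • Matrix.single i i (1 : ℂ)
  map_add' σ τ := by
    simp [Matrix.mul_add, Matrix.trace_add, add_smul, Finset.sum_add_distrib]
  map_smul' c σ := by
    simp [Finset.smul_sum]

/-- The effects `|ψᵢ⟩⟨ψᵢ|` of the von Neumann measurement in the basis `ψᵢ = U|i⟩`
formed by the columns of the matrix `U`. -/
def vonNeumann {d : ℕ} (U : Matrix (Fin d) (Fin d) ℂ) : Fin d → Matrix (Fin d) (Fin d) ℂ :=
  fun i => ketbra (fun a => U a i)

/-- The von Neumann measurement in the basis `U|i⟩`, as a quantum channel. -/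
def vnChannel {d : ℕ} (U : Matrix (Fin d) (Fin d) ℂ) :
    Matrix (Fin d) (Fin d) ℂ →ₗ[ℂ] Matrix (Fin d) (Fin d) ℂ :=
  measChannel (vonNeumann U)

/-- `(S ⊗ id_k)(X)`: the map `S` is applied to each of the `k × k` blocks
`X^{j j'} = (1 ⊗ ⟨j|) X (1 ⊗ |j'⟩)` of `X`. -/
def ampliate {n m : Type*} (S : Matrix n n ℂ →ₗ[ℂ] Matrix m m ℂ) (k : ℕ)
    (X : Matrix (n × Fin k) (n × Fin k) ℂ) : Matrix (m × Fin k) (m × Fin k) ℂ :=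
  Matrix.of fun p q => S (Matrix.of fun i i' => X (i, p.2) (i', q.2)) p.1 q.1

/-- The values `‖(S ⊗ id_k)(X)‖₁` with `‖X‖₁ = 1`, over all finite-dimensional ancillas. -/
def diamondValues {n m : Type*} [Fintype n] [DecidableEq n] [Fintype m] [DecidableEq m]
    (S : Matrix n n ℂ →ₗ[ℂ] Matrix m m ℂ) : Set ℝ :=
  {r | ∃ (k : ℕ) (X : Matrix (n × Fin k) (n × Fin k) ℂ),
    traceNorm X = 1 ∧ r = traceNorm (ampliate S k X)}

/-- The diamond norm. -/
def diamondNorm {n m : Type*} [Fintype n] [DecidableEq n] [Fintype m] [DecidableEq m]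
    (S : Matrix n n ℂ →ₗ[ℂ] Matrix m m ℂ) : ℝ :=
  sSup (diamondValues S)

/-- The three-outcome measurement `M` discriminates `σ₁` and `σ₂` unambiguously.
Outcome `0` announces `σ₁`, outcome `1` announces `σ₂`, outcome `2` is inconclusive. -/
def IsUnambiguous {n : Type*} [Fintype n] [DecidableEq n] (σ₁ σ₂ : Matrix n n ℂ)
    (M : Fin 3 → Matrix n n ℂ) : Prop :=
  IsPOVM M ∧ (M 1 * σ₁).trace = 0 ∧ (M 0 * σ₂).trace = 0

/-- The success probability for equal a priori probabilities. The operators `σ₁`, `σ₂` may be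
subnormalized; their traces then act as additional weights. -/
def successProb {n : Type*} [Fintype n] (σ₁ σ₂ : Matrix n n ℂ)
    (M : Fin 3 → Matrix n n ℂ) : ℝ :=
  (1 / 2 : ℝ) * ((M 0 * σ₁).trace.re + (M 1 * σ₂).trace.re)

/-- `M` is an optimal measurement for the unambiguous discrimination of `σ₁` and `σ₂`. -/
def IsOptimalUnambiguous {n : Type*} [Fintype n] [DecidableEq n] (σ₁ σ₂ : Matrix n n ℂ)
    (M : Fin 3 → Matrix n n ℂ) : Prop :=
  IsUnambiguous σ₁ σ₂ M ∧
    ∀ M' : Fin 3 → Matrix n n ℂ, IsUnambiguous σ₁ σ₂ M' →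
      successProb σ₁ σ₂ M' ≤ successProb σ₁ σ₂ M

/-- Success probabilities of all strategies with a `k`-dimensional ancilla that discriminate
the channels `Φ₁` and `Φ₂` unambiguously. -/
def entUnambValues {n m : Type*} [Fintype n] [Fintype m] [DecidableEq m]
    (Φ₁ Φ₂ : Matrix n n ℂ →ₗ[ℂ] Matrix m m ℂ) (k : ℕ) : Set ℝ :=
  {r | ∃ (σ : Matrix (n × Fin k) (n × Fin k) ℂ)
      (M : Fin 3 → Matrix (m × Fin k) (m × Fin k) ℂ),
    IsDensity σ ∧ IsUnambiguous (ampliate Φ₁ k σ) (ampliate Φ₂ k σ) M ∧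
      r = successProb (ampliate Φ₁ k σ) (ampliate Φ₂ k σ) M}

/-- The optimal entanglement-assisted unambiguous discrimination probability: the supremum over
all ancilla dimensions, input states and unambiguous measurements. -/
def entUnambProb {n m : Type*} [Fintype n] [Fintype m] [DecidableEq m]
    (Φ₁ Φ₂ : Matrix n n ℂ →ₗ[ℂ] Matrix m m ℂ) : ℝ :=
  sSup (⋃ k, entUnambValues Φ₁ Φ₂ k)

/-- The vector `(⟨i|U† ⊗ 1)|ψ⟩` left on the ancilla when the von Neumann measurement in the
basis `U|i⟩` gives the label `i`. Its squared norm is the probability of the label. -/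
def ancillaVec {d k : ℕ} (U : Matrix (Fin d) (Fin d) ℂ) (ψ : Fin d × Fin k → ℂ) (i : Fin d) :
    Fin k → ℂ :=
  fun j => ∑ a, star (U a i) * ψ (a, j)

/-- The measurement that reads the label `i` and then performs the measurement `T i` on the
ancilla; its effects are `∑ i, |i⟩⟨i| ⊗ T i a`. -/
def labelMeasurement {d k : ℕ} (T : Fin d → Fin 3 → Matrix (Fin k) (Fin k) ℂ) :
    Fin 3 → Matrix (Fin d × Fin k) (Fin d × Fin k) ℂ :=
  fun a => ∑ i, Matrix.single i i (1 : ℂ) ⊗ₖ T i a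

end

/-! Both quantities are governed by one number, the minimum `m` over density matrices `ρ` of the sum
of the moduli of the diagonal entries of `U₁ᴴ * ρ * U₂`. The discrimination probability is `1 - m`
and the diamond norm is `2 * √(1 - m ^ 2)`, whence the relation between them.

For a pure input both outputs are block diagonal with rank-one blocks, and the norms and the moduli
of the overlaps of the block vectors `a i`, `b i` depend only on the reduced state `ρ`: the overlap
has modulus `‖(U₁ᴴ * ρ * U₂) i i‖`. Unambiguous discrimination of one block succeeds with weight at
most `(‖a‖² + ‖b‖²) / 2 - |⟨a, b⟩|` (`successProb_ketbra_le`), and summation over the labels gives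
`1 - m`. For the trace norm, `IsContraction.re_sub_le` bounds each block, and Cauchy–Schwarz over
the labels gives `2 * √(1 - m ^ 2)` (`traceNorm_ampliate_le`).

Neither bound is attained by an arbitrary minimizer. The first needs overlaps not exceeding either
squared norm, the second needs overlaps proportional to the weights of the blocks. The heart of the
proof is therefore `exists_balanced_minimizer`. When `m > 0`, separating an ℓ¹ ball from the set of
diagonals of `ρ * U` yields a diagonal `E` with entries in the unit disc such that `V = U * diagonal
E` satisfies `V + Vᴴ ≥ 2m`. Complementary slackness puts a minimizer `ρ` on the kernel of `V + Vᴴ -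
2m`, and also lets `E` be made unimodular without losing the relations with `ρ`. Then `V` is
unitary, and pinching `ρ` to the eigenspaces of `V` gives a state commuting with `V`, whose diagonal
entries are balanced. When `m = 0` all overlaps vanish and nothing is needed. A purification of the
balanced state is optimal for both problems. -/

/-- The squared Euclidean norm of a vector. -/
noncomputable def normSq {n : Type*} [Fintype n] (x : n → ℂ) : ℝ := ∑ i, ‖x i‖ ^ 2

/-! ### Euclidean norms, inner products and rank-one operators -/

section vectors

variable {n m : Type*} [Fintype n] [Fintype m]

theorem normSq_nonneg (x : n → ℂ) : 0 ≤ normSq x :=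
  Finset.sum_nonneg fun _ _ => by positivity

theorem star_dotProduct_self (x : n → ℂ) : star x ⬝ᵥ x = (normSq x : ℂ) := by
  simp only [dotProduct, normSq, Pi.star_apply, RCLike.star_def, Complex.conj_mul']
  push_cast
  rfl

theorem normSq_eq_re (x : n → ℂ) : normSq x = (star x ⬝ᵥ x).re := by
  rw [star_dotProduct_self, Complex.ofReal_re]

theorem normSq_eq_zero {x : n → ℂ} : normSq x = 0 ↔ x = 0 := by
  rw [← dotProduct_star_self_eq_zero (v := x), star_dotProduct_self,
    Complex.ofReal_eq_zero]

theorem normSq_smul (c : ℂ) (x : n → ℂ) : normSq (c • x) = ‖c‖ ^ 2 * normSq x := by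
  simp [normSq, mul_pow, Finset.mul_sum]

theorem normSq_mulVec (A : Matrix m n ℂ) (x : n → ℂ) :
    normSq (A *ᵥ x) = (star x ⬝ᵥ ((Aᴴ * A) *ᵥ x)).re := by
  rw [normSq_eq_re, Matrix.star_mulVec, ← Matrix.mulVec_mulVec, ← Matrix.dotProduct_mulVec]

theorem normSq_add (x y : n → ℂ) :
    normSq (x + y) = normSq x + normSq y + 2 * (star x ⬝ᵥ y).re := by
  simp only [normSq_eq_re, star_add, add_dotProduct, dotProduct_add, Complex.add_re]
  have : (star y ⬝ᵥ x).re = (star x ⬝ᵥ y).re := by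
    rw [Matrix.star_dotProduct, ← dotProduct_comm, Complex.star_def, Complex.conj_re]
  rw [this]; ring

theorem normSq_sub (x y : n → ℂ) :
    normSq (x - y) = normSq x + normSq y - 2 * (star x ⬝ᵥ y).re := by
  have h : normSq (-y) = normSq y := by simp [normSq]
  rw [sub_eq_add_neg, normSq_add, h]
  simp
  ring

theorem star_dotProduct_comm (x y : n → ℂ) : star y ⬝ᵥ x = star (star x ⬝ᵥ y) := by
  rw [Matrix.star_dotProduct, ← dotProduct_comm]

/-- The Cauchy–Schwarz inequality. -/
theorem norm_star_dotProduct_le (x y : n → ℂ) :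
    ‖star x ⬝ᵥ y‖ ≤ √(normSq x) * √(normSq y) := by
  calc ‖star x ⬝ᵥ y‖ ≤ ∑ i, ‖x i‖ * ‖y i‖ := by
        refine (norm_sum_le _ _).trans (le_of_eq ?_)
        simp
    _ ≤ _ := Real.sum_mul_le_sqrt_mul_sqrt _ _ _

theorem norm_star_dotProduct_le_half (x y : n → ℂ) :
    ‖star x ⬝ᵥ y‖ ≤ (normSq x + normSq y) / 2 := by
  have := norm_star_dotProduct_le x y
  have h1 := Real.sq_sqrt (normSq_nonneg x)
  have h2 := Real.sq_sqrt (normSq_nonneg y)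
  nlinarith [sq_nonneg (√(normSq x) - √(normSq y))]

theorem trace_mul_vecMulVec_star (M : Matrix n n ℂ) (x y : n → ℂ) :
    (M * Matrix.vecMulVec x (star y)).trace = star y ⬝ᵥ (M *ᵥ x) := by
  rw [Matrix.mul_vecMulVec, Matrix.trace_vecMulVec, dotProduct_comm]

theorem trace_mul_ketbra (M : Matrix n n ℂ) (x : n → ℂ) :
    (M * ketbra x).trace = star x ⬝ᵥ (M *ᵥ x) :=
  trace_mul_vecMulVec_star M x x

theorem ketbra_posSemidef (x : n → ℂ) : (ketbra x).PosSemidef :=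
  Matrix.posSemidef_vecMulVec_self_star x

theorem ketbra_isDensity {x : n → ℂ} (hx : star x ⬝ᵥ x = 1) : IsDensity (ketbra x) :=
  ⟨ketbra_posSemidef x, by rw [ketbra, Matrix.trace_vecMulVec, dotProduct_comm, hx]⟩

omit [Fintype n] in
theorem mul_conjTranspose_eq_sum_ketbra (C : Matrix n m ℂ) :
    C * Cᴴ = ∑ j, ketbra (fun i => C i j) := by
  ext i i'
  simp [Matrix.mul_apply, ketbra, Matrix.vecMulVec_apply, Matrix.sum_apply]

end vectors

/-! ### Positive semidefinite matrices -/

namespace Matrix.PosSemidef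

variable {n m : Type*} [Fintype n] [Fintype m]

theorem exists_eq_conjTranspose_mul_self {A : Matrix n n ℂ} (hA : A.PosSemidef) :
    ∃ C : Matrix n n ℂ, A = Cᴴ * C := by
  classical
  open scoped MatrixOrder in
  exact CStarAlgebra.nonneg_iff_eq_star_mul_self.mp hA.nonneg

theorem exists_eq_mul_conjTranspose {A : Matrix n n ℂ} (hA : A.PosSemidef) :
    ∃ C : Matrix n n ℂ, A = C * Cᴴ := by
  obtain ⟨C, hC⟩ := hA.exists_eq_conjTranspose_mul_self
  exact ⟨Cᴴ, by rw [hC, conjTranspose_conjTranspose]⟩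

theorem trace_mul_nonneg {A B : Matrix n n ℂ} (hA : A.PosSemidef) (hB : B.PosSemidef) :
    0 ≤ (A * B).trace := by
  obtain ⟨C, rfl⟩ := hB.exists_eq_mul_conjTranspose
  rw [← Matrix.mul_assoc, Matrix.trace_mul_comm, ← Matrix.mul_assoc]
  exact (hA.conjTranspose_mul_mul_same C).trace_nonneg

/-- With `A = Cᴴ * C` and `B = D * Dᴴ`, the trace is the squared Hilbert–Schmidt norm of `C * D`.
This turns equality of traces into operator identities (complementary slackness). -/
theorem mul_eq_zero_of_trace_mul_eq_zero {A B : Matrix n n ℂ} (hA : A.PosSemidef)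
    (hB : B.PosSemidef) (h : (A * B).trace = 0) : A * B = 0 := by
  obtain ⟨C, rfl⟩ := hA.exists_eq_conjTranspose_mul_self
  obtain ⟨D, rfl⟩ := hB.exists_eq_mul_conjTranspose
  have h0 : C * D = 0 := by
    rw [← Matrix.trace_conjTranspose_mul_self_eq_zero_iff, Matrix.conjTranspose_mul, ← h,
      Matrix.trace_mul_comm]
    rw [Matrix.trace_mul_comm, ← Matrix.mul_assoc, Matrix.trace_mul_comm]
    simp only [Matrix.mul_assoc]
    rw [← Matrix.mul_assoc D, Matrix.trace_mul_comm (D * Dᴴ), Matrix.mul_assoc]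
  rw [Matrix.mul_assoc, ← Matrix.mul_assoc C, h0, Matrix.zero_mul, Matrix.mul_zero]

/-- Cauchy–Schwarz for the form of `A`, followed by the inequality of arithmetic and geometric
means. -/
theorem norm_star_dotProduct_mulVec_le {A : Matrix n n ℂ} (hA : A.PosSemidef) (x y : n → ℂ) :
    ‖star x ⬝ᵥ (A *ᵥ y)‖ ≤ ((star x ⬝ᵥ (A *ᵥ x)).re + (star y ⬝ᵥ (A *ᵥ y)).re) / 2 := by
  obtain ⟨C, rfl⟩ := hA.exists_eq_conjTranspose_mul_self
  rw [← normSq_mulVec, ← normSq_mulVec, ← Matrix.mulVec_mulVec, Matrix.dotProduct_mulVec,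
    ← Matrix.star_mulVec]
  exact norm_star_dotProduct_le_half _ _

theorem norm_apply_le {A : Matrix n n ℂ} (hA : A.PosSemidef) (i j : n) :
    ‖A i j‖ ≤ ((A i i).re + (A j j).re) / 2 := by
  classical
  have := hA.norm_star_dotProduct_mulVec_le (Pi.single i 1) (Pi.single j 1)
  simpa [← Pi.single_star] using this

theorem norm_apply_le_re_trace {A : Matrix n n ℂ} (hA : A.PosSemidef) (i j : n) :
    ‖A i j‖ ≤ A.trace.re := by
  have h (i : n) : (A i i).re ≤ A.trace.re := by
    rw [Matrix.trace, Complex.re_sum]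
    exact Finset.single_le_sum (f := fun i => (A.diag i).re)
      (fun i _ => (Complex.nonneg_iff.1 hA.diag_nonneg).1) (Finset.mem_univ i)
  linarith [hA.norm_apply_le i j, h i, h j]

theorem ofReal_re_trace {A : Matrix n n ℂ} (hA : A.PosSemidef) : (A.trace.re : ℂ) = A.trace :=
  Complex.ext rfl (Complex.nonneg_iff.1 hA.trace_nonneg).2

end Matrix.PosSemidef

/-! ### Compactness of states and measurements -/

section compactness

variable {n : Type*} [Fintype n]

theorem isClosed_setOf_posSemidef : IsClosed {A : Matrix n n ℂ | A.PosSemidef} := by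
  simp only [Matrix.posSemidef_iff_dotProduct_mulVec, Matrix.IsHermitian, Set.ofPred_and,
    Set.ofPred_forall]
  refine IsClosed.inter (isClosed_eq (by fun_prop) (by fun_prop)) (isClosed_iInter fun x => ?_)
  exact isClosed_le continuous_const (by fun_prop)

omit [Fintype n] in
theorem isCompact_setOf_norm_apply_le_one : IsCompact {A : Matrix n n ℂ | ∀ i j, ‖A i j‖ ≤ 1} := by
  have : {A : Matrix n n ℂ | ∀ i j, ‖A i j‖ ≤ 1} =
      Set.pi Set.univ fun _ => Set.pi Set.univ fun _ => Metric.closedBall (0 : ℂ) 1 := by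
    ext A
    simp only [Set.mem_ofPred_eq, ← mem_closedBall_zero_iff]
    exact ⟨fun h i _ j _ => h i j, fun h i j => h i trivial j trivial⟩
  rw [this]
  exact isCompact_univ_pi fun _ => isCompact_univ_pi fun _ => isCompact_closedBall _ _

theorem isCompact_setOf_isDensity : IsCompact {ρ : Matrix n n ℂ | IsDensity ρ} := by
  refine isCompact_setOf_norm_apply_le_one.of_isClosed_subset
    (isClosed_setOf_posSemidef.inter (isClosed_eq (by fun_prop) continuous_const)) ?_
  rintro ρ ⟨h1, h2⟩ i j
  simpa [h2] using h1.norm_apply_le_re_trace i j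

variable [DecidableEq n]

theorem isCompact_setOf_isPOVM {o : Type*} [Fintype o] :
    IsCompact {M : o → Matrix n n ℂ | IsPOVM M} := by
  refine (isCompact_univ_pi fun _ : o => isCompact_setOf_norm_apply_le_one
    (n := n)).of_isClosed_subset ?_ ?_
  · simp only [IsPOVM, Set.ofPred_and, Set.ofPred_forall]
    refine IsClosed.inter (isClosed_iInter fun i => ?_) (isClosed_eq (by fun_prop) continuous_const)
    exact isClosed_setOf_posSemidef.preimage (f := fun M : o → Matrix n n ℂ => M i)
      (continuous_apply i)
  · rintro M ⟨h1, h2⟩ x - i j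
    have h (i : n) : (M x i i).re ≤ 1 := by
      calc (M x i i).re ≤ ∑ y, (M y i i).re :=
            Finset.single_le_sum (f := fun y => (M y i i).re)
              (fun y _ => (Complex.nonneg_iff.1 (h1 y).diag_nonneg).1) (Finset.mem_univ x)
        _ = ((∑ y, M y) i i).re := by rw [Matrix.sum_apply, Complex.re_sum]
        _ = 1 := by simp [h2]
    linarith [(h1 x).norm_apply_le i j, h i, h j]

/-- Optimal unambiguous measurements exist. -/
theorem exists_isOptimalUnambiguous (σ₁ σ₂ : Matrix n n ℂ) :
    ∃ M, IsOptimalUnambiguous σ₁ σ₂ M := by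
  have hc : IsCompact {M : Fin 3 → Matrix n n ℂ | IsUnambiguous σ₁ σ₂ M} := by
    have : {M : Fin 3 → Matrix n n ℂ | IsUnambiguous σ₁ σ₂ M} =
      {M | IsPOVM M} ∩ ({M | (M 1 * σ₁).trace = 0} ∩ {M | (M 0 * σ₂).trace = 0}) := rfl
    rw [this]
    refine isCompact_setOf_isPOVM.inter_right ?_
    exact (isClosed_eq (by fun_prop) continuous_const).inter
      (isClosed_eq (by fun_prop) continuous_const)
  have hne : {M : Fin 3 → Matrix n n ℂ | IsUnambiguous σ₁ σ₂ M}.Nonempty := by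
    -- The measurement that is always inconclusive is unambiguous.
    refine ⟨![0, 0, 1], ⟨fun i => ?_, ?_⟩, ?_, ?_⟩
    · fin_cases i
      · exact Matrix.PosSemidef.zero
      · exact Matrix.PosSemidef.zero
      · exact Matrix.PosSemidef.one
    · simp [Fin.sum_univ_three]
    · simp
    · simp
  have hcont : Continuous (successProb σ₁ σ₂) := by
    unfold successProb
    fun_prop
  obtain ⟨M, hM, hmax⟩ := hc.exists_isMaxOn hne hcont.continuousOn
  exact ⟨M, hM, fun M' hM' => hmax hM'⟩

end compactness

/-! ### Unambiguous discrimination of two weighted pure states -/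

section pureStates

variable {n : Type*} [Fintype n] [DecidableEq n]

omit [DecidableEq n] in
theorem star_dotProduct_ketbra_mulVec (w x : n → ℂ) :
    star x ⬝ᵥ (ketbra w *ᵥ x) = ((‖star x ⬝ᵥ w‖ ^ 2 : ℝ) : ℂ) := by
  rw [ketbra, Matrix.vecMulVec_mulVec, op_smul_eq_smul, dotProduct_smul, star_dotProduct_comm x w,
    smul_eq_mul, Complex.star_def, Complex.conj_mul', Complex.ofReal_pow]

/-- The upper bound on unambiguous discrimination of two pure states. -/
theorem successProb_ketbra_le {a b : n → ℂ} {M : Fin 3 → Matrix n n ℂ}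
    (hM : IsUnambiguous (ketbra a) (ketbra b) M) :
    successProb (ketbra a) (ketbra b) M ≤ (normSq a + normSq b) / 2 - ‖star a ⬝ᵥ b‖ := by
  obtain ⟨⟨hpos, hsum⟩, h1, h0⟩ := hM
  rw [trace_mul_ketbra, (hpos _).dotProduct_mulVec_zero_iff] at h1 h0
  rw [Fin.sum_univ_three] at hsum
  have key (x y : n → ℂ) : star x ⬝ᵥ y =
      star x ⬝ᵥ (M 0 *ᵥ y) + star x ⬝ᵥ (M 1 *ᵥ y) + star x ⬝ᵥ (M 2 *ᵥ y) := by
    rw [← dotProduct_add, ← dotProduct_add, ← Matrix.add_mulVec, ← Matrix.add_mulVec, hsum,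
      Matrix.one_mulVec]
  -- Unambiguity means `M 1` kills `a` and `M 0` kills `b`, so the whole overlap of `a` and `b` is
  -- carried by the inconclusive effect, whose weight it therefore bounds from below.
  have hab : star a ⬝ᵥ (M 1 *ᵥ b) = 0 := by
    rw [Matrix.dotProduct_mulVec, ← (hpos 1).1, ← Matrix.star_mulVec, h1]
    simp
  have e1 := key a b
  have e2 := key a a
  have e3 := key b b
  rw [hab, h0] at e1
  rw [h1] at e2
  rw [h0] at e3
  simp only [dotProduct_zero, zero_add, add_zero] at e1 e2 e3
  have e4 := (hpos 2).norm_star_dotProduct_mulVec_le a b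
  rw [← e1] at e4
  rw [successProb, trace_mul_ketbra, trace_mul_ketbra, normSq_eq_re, normSq_eq_re, e2, e3,
    Complex.add_re, Complex.add_re]
  linarith

/-- The hypotheses say that the Gram matrix `G` of `u`, `v` satisfies `G ≤ 1`. With `T = [u v]` one
has `G = Tᴴ * T`, and `T * Tᴴ ≤ 1` follows. -/
theorem one_sub_ketbra_sub_ketbra_posSemidef {u v : n → ℂ} (hu : normSq u ≤ 1) (hv : normSq v ≤ 1)
    (huv : ‖star u ⬝ᵥ v‖ ^ 2 ≤ (1 - normSq u) * (1 - normSq v)) :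
    (1 - ketbra u - ketbra v).PosSemidef := by
  refine .of_dotProduct_mulVec_nonneg
    ((Matrix.isHermitian_one.sub (ketbra_posSemidef u).1).sub (ketbra_posSemidef v).1) fun x => ?_
  have hq (w : n → ℂ) : star x ⬝ᵥ (ketbra w *ᵥ x) = ((‖star w ⬝ᵥ x‖ ^ 2 : ℝ) : ℂ) := by
    rw [star_dotProduct_ketbra_mulVec, star_dotProduct_comm w x, norm_star]
  rw [Matrix.sub_mulVec, Matrix.sub_mulVec, dotProduct_sub, dotProduct_sub, hq, hq,
    Matrix.one_mulVec, star_dotProduct_self, ← Complex.ofReal_sub, ← Complex.ofReal_sub,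
    Complex.zero_le_real]
  set p := star u ⬝ᵥ x with hp
  set q := star v ⬝ᵥ x with hq
  -- Expanding gives `0 ≤ ‖x‖² - 2 (|p|² + |q|²) + ‖p u + q v‖²`, and the Gram condition bounds the
  -- last term by `|p|² + |q|²`.
  have h := normSq_nonneg (x - (p • u + q • v))
  have hxy : (star x ⬝ᵥ (p • u + q • v)).re = ‖p‖ ^ 2 + ‖q‖ ^ 2 := by
    rw [dotProduct_add, dotProduct_smul, dotProduct_smul, star_dotProduct_comm u x,
      star_dotProduct_comm v x, ← hp, ← hq]
    simp only [smul_eq_mul, Complex.star_def, Complex.mul_conj']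
    norm_cast
  have hyy : normSq (p • u + q • v) ≤ ‖p‖ ^ 2 * normSq u + ‖q‖ ^ 2 * normSq v +
      2 * (‖p‖ * ‖q‖ * ‖star u ⬝ᵥ v‖) := by
    rw [normSq_add, normSq_smul, normSq_smul]
    have : (star (p • u) ⬝ᵥ (q • v)).re ≤ ‖p‖ * ‖q‖ * ‖star u ⬝ᵥ v‖ := by
      refine (Complex.re_le_norm _).trans (le_of_eq ?_)
      simp [mul_assoc, mul_left_comm]
    linarith
  rw [normSq_sub, hxy] at h
  set g := ‖star u ⬝ᵥ v‖
  have hg : 2 * (‖p‖ * ‖q‖ * g) ≤ ‖p‖ ^ 2 * (1 - normSq u) + ‖q‖ ^ 2 * (1 - normSq v) := by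
    have h1 : 0 ≤ ‖p‖ ^ 2 * (1 - normSq u) := mul_nonneg (sq_nonneg _) (by linarith)
    have h2 : 0 ≤ ‖q‖ ^ 2 * (1 - normSq v) := mul_nonneg (sq_nonneg _) (by linarith)
    refine abs_le_of_sq_le_sq' ?_ (by linarith) |>.2
    have h3 : (‖p‖ * ‖q‖) ^ 2 * g ^ 2 ≤ (‖p‖ * ‖q‖) ^ 2 * ((1 - normSq u) * (1 - normSq v)) :=
      mul_le_mul_of_nonneg_left huv (sq_nonneg _)
    nlinarith [sq_nonneg (‖p‖ ^ 2 * (1 - normSq u) - ‖q‖ ^ 2 * (1 - normSq v))]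
  linarith

theorem exists_isUnambiguous_of_orthogonal {a b u v : n → ℂ} (hu : normSq u ≤ 1)
    (hv : normSq v ≤ 1) (huv : ‖star u ⬝ᵥ v‖ ^ 2 ≤ (1 - normSq u) * (1 - normSq v))
    (hub : star b ⬝ᵥ u = 0) (hva : star a ⬝ᵥ v = 0) :
    ∃ M, IsUnambiguous (ketbra a) (ketbra b) M ∧
      successProb (ketbra a) (ketbra b) M = (‖star a ⬝ᵥ u‖ ^ 2 + ‖star b ⬝ᵥ v‖ ^ 2) / 2 := by
  refine ⟨![ketbra u, ketbra v, 1 - ketbra u - ketbra v], ⟨⟨fun i => ?_, ?_⟩, ?_, ?_⟩, ?_⟩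
  · fin_cases i
    · exact ketbra_posSemidef u
    · exact ketbra_posSemidef v
    · exact one_sub_ketbra_sub_ketbra_posSemidef hu hv huv
  · simp [Fin.sum_univ_three]
  · simp [trace_mul_ketbra, star_dotProduct_ketbra_mulVec, hva]
  · simp [trace_mul_ketbra, star_dotProduct_ketbra_mulVec, hub]
  · simp only [successProb, trace_mul_ketbra, Matrix.cons_val_zero, Matrix.cons_val_one,
      star_dotProduct_ketbra_mulVec, Complex.ofReal_re]
    ring

/-- The bound `successProb_ketbra_le` is attained if the overlap does not exceed the weights. -/
theorem exists_isUnambiguous_ketbra {a b : n → ℂ} (ha : ‖star a ⬝ᵥ b‖ ≤ normSq a)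
    (hb : ‖star a ⬝ᵥ b‖ ≤ normSq b) :
    ∃ M, IsUnambiguous (ketbra a) (ketbra b) M ∧
      successProb (ketbra a) (ketbra b) M = (normSq a + normSq b) / 2 - ‖star a ⬝ᵥ b‖ := by
  have hba : star b ⬝ᵥ a = star (star a ⬝ᵥ b) := star_dotProduct_comm a b
  set g := star a ⬝ᵥ b with hg
  set A := normSq a
  set B := normSq b
  have hA0 : 0 ≤ A := normSq_nonneg a
  have hB0 : 0 ≤ B := normSq_nonneg b
  have haa : star a ⬝ᵥ a = (A : ℂ) := star_dotProduct_self a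
  have hbb : star b ⬝ᵥ b = (B : ℂ) := star_dotProduct_self b
  -- Orthogonal vectors: the projections onto `a` and `b` discriminate perfectly. A zero vector is
  -- covered because its normalizing factor is then `0⁻¹ = 0`.
  obtain hc | hc := (norm_nonneg g).eq_or_lt
  · have hg0 : g = 0 := norm_eq_zero.1 hc.symm
    have hsq (w : n → ℂ) : normSq (((√(normSq w))⁻¹ : ℂ) • w) ≤ 1 := by
      rw [normSq_smul, norm_inv, Complex.norm_real, Real.norm_of_nonneg (Real.sqrt_nonneg _),
        inv_pow, Real.sq_sqrt (normSq_nonneg w)]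
      exact inv_mul_le_one
    have hval (w : n → ℂ) : ‖star w ⬝ᵥ (((√(normSq w))⁻¹ : ℂ) • w)‖ ^ 2 = normSq w := by
      rw [dotProduct_smul, star_dotProduct_self, smul_eq_mul, norm_mul, norm_inv,
        Complex.norm_real, Complex.norm_real, Real.norm_of_nonneg (Real.sqrt_nonneg _),
        Real.norm_of_nonneg (normSq_nonneg w), mul_pow, inv_pow, Real.sq_sqrt (normSq_nonneg w)]
      obtain h | h := eq_or_ne (normSq w) 0
      · simp [h]
      · field_simp
    obtain ⟨M, hM, hs⟩ := exists_isUnambiguous_of_orthogonal (hsq a) (hsq b) (a := a) (b := b)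
      (by
        simp only [star_smul, smul_dotProduct, dotProduct_smul, ← hg, hg0, smul_zero, norm_zero]
        have := mul_nonneg (sub_nonneg.2 (hsq a)) (sub_nonneg.2 (hsq b))
        simpa using this)
      (by rw [dotProduct_smul, hba, hg0]; simp) (by rw [dotProduct_smul, ← hg, hg0]; simp)
    refine ⟨M, hM, ?_⟩
    rw [hs, hval, hval, ← hc, sub_zero]
  set c := ‖g‖ with hcg
  have hgg : g * star g = ((c ^ 2 : ℝ) : ℂ) := by
    rw [Complex.star_def, Complex.mul_conj', Complex.ofReal_pow]
  have hgg' : star g * g = ((c ^ 2 : ℝ) : ℂ) := by rw [mul_comm, hgg]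
  have hAp : 0 < A := hc.trans_le ha
  have hBp : 0 < B := hc.trans_le hb
  have hcs : c ^ 2 ≤ A * B := by nlinarith
  -- If `c² = A * B`, then `c ≤ A` and `c ≤ B` force `A = B = c`; the claimed value is zero and the
  -- inconclusive measurement attains it.
  obtain hcs | hcs := hcs.eq_or_lt
  · refine ⟨![0, 0, 1], ⟨⟨fun i => ?_, ?_⟩, by simp, by simp⟩, ?_⟩
    · fin_cases i
      · exact Matrix.PosSemidef.zero
      · exact Matrix.PosSemidef.zero
      · exact Matrix.PosSemidef.one
    · simp [Fin.sum_univ_three]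
    · have h1 : A = c := by nlinarith
      have h2 : B = c := by nlinarith
      simp [successProb, h1, h2]
  set D := A * B - c ^ 2 with hD
  have hDp : 0 < D := by linarith
  have hAc : (A : ℂ) ≠ 0 := by exact_mod_cast hAp.ne'
  have hBc : (B : ℂ) ≠ 0 := by exact_mod_cast hBp.ne'
  set u₀ := a - (star g / B) • b with hu₀
  set v₀ := b - (g / A) • a with hv₀
  have hbu : star b ⬝ᵥ u₀ = 0 := by
    rw [hu₀, dotProduct_sub, dotProduct_smul, hba, hbb, smul_eq_mul, div_mul_cancel₀ _ hBc,
      sub_self]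
  have hav : star a ⬝ᵥ v₀ = 0 := by
    rw [hv₀, dotProduct_sub, dotProduct_smul, ← hg, haa, smul_eq_mul, div_mul_cancel₀ _ hAc,
      sub_self]
  have hau : star a ⬝ᵥ u₀ = ((D / B : ℝ) : ℂ) := by
    rw [hu₀, dotProduct_sub, dotProduct_smul, haa, ← hg, smul_eq_mul, div_mul_eq_mul_div, hgg']
    push_cast [hD]
    field_simp
  have hbv : star b ⬝ᵥ v₀ = ((D / A : ℝ) : ℂ) := by
    rw [hv₀, dotProduct_sub, dotProduct_smul, hbb, hba, smul_eq_mul, div_mul_eq_mul_div, hgg]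
    push_cast [hD]
    field_simp
  have hub : star u₀ ⬝ᵥ b = 0 := by rw [star_dotProduct_comm, hbu, star_zero]
  have hua : star u₀ ⬝ᵥ a = ((D / B : ℝ) : ℂ) := by
    rw [star_dotProduct_comm, hau, Complex.star_def, Complex.conj_ofReal]
  have hva : star v₀ ⬝ᵥ a = 0 := by rw [star_dotProduct_comm, hav, star_zero]
  have hvb : star v₀ ⬝ᵥ b = ((D / A : ℝ) : ℂ) := by
    rw [star_dotProduct_comm, hbv, Complex.star_def, Complex.conj_ofReal]
  have huu : normSq u₀ = D / B := by
    rw [normSq_eq_re]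
    nth_rewrite 2 [hu₀]
    rw [dotProduct_sub, dotProduct_smul, hub, hua, smul_zero, sub_zero, Complex.ofReal_re]
  have hvv : normSq v₀ = D / A := by
    rw [normSq_eq_re]
    nth_rewrite 2 [hv₀]
    rw [dotProduct_sub, dotProduct_smul, hva, hvb, smul_zero, sub_zero, Complex.ofReal_re]
  have huv : ‖star u₀ ⬝ᵥ v₀‖ = c * D / (A * B) := by
    rw [hv₀, dotProduct_sub, dotProduct_smul, hub, hua, zero_sub, norm_neg, smul_eq_mul, norm_mul,
      norm_div, Complex.norm_real, Complex.norm_real, Real.norm_of_nonneg hA0,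
      Real.norm_of_nonneg (by positivity), ← hcg]
    field_simp
  -- The scale is fixed by requiring the first success weight `x² (D / B)²` to equal `A - c`; `y`
  -- does the same for `B - c`. The Gram condition then holds with equality.
  obtain ⟨x, hx0, hx2⟩ : ∃ x : ℝ, 0 ≤ x ∧ x ^ 2 = (A - c) * (B / D) ^ 2 :=
    ⟨√(A - c) * (B / D), by positivity, by rw [mul_pow, Real.sq_sqrt (by linarith)]⟩
  obtain ⟨y, hy0, hy2⟩ : ∃ y : ℝ, 0 ≤ y ∧ y ^ 2 = (B - c) * (A / D) ^ 2 :=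
    ⟨√(B - c) * (A / D), by positivity, by rw [mul_pow, Real.sq_sqrt (by linarith)]⟩
  have hxu : normSq ((x : ℂ) • u₀) = B * (A - c) / D := by
    rw [normSq_smul, Complex.norm_real, Real.norm_of_nonneg hx0, hx2, huu]
    field_simp
  have hyv : normSq ((y : ℂ) • v₀) = A * (B - c) / D := by
    rw [normSq_smul, Complex.norm_real, Real.norm_of_nonneg hy0, hy2, hvv]
    field_simp
  have h1 : 1 - B * (A - c) / D = c * (B - c) / D := by
    rw [one_sub_div hDp.ne', hD]; ring
  have h2 : 1 - A * (B - c) / D = c * (A - c) / D := by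
    rw [one_sub_div hDp.ne', hD]; ring
  have hBc' : 0 ≤ B - c := by linarith
  have hAc' : 0 ≤ A - c := by linarith
  obtain ⟨M, hM, hs⟩ := exists_isUnambiguous_of_orthogonal (a := a) (b := b)
    (u := (x : ℂ) • u₀) (v := (y : ℂ) • v₀)
    (by rw [hxu, ← sub_nonneg, h1]; positivity) (by rw [hyv, ← sub_nonneg, h2]; positivity)
    (by
      rw [hxu, hyv, h1, h2, star_smul, smul_dotProduct, dotProduct_smul, norm_smul, norm_smul,
        norm_star, Complex.norm_real, Complex.norm_real, Real.norm_of_nonneg hx0,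
        Real.norm_of_nonneg hy0, huv, mul_pow, mul_pow y, hx2, hy2]
      apply le_of_eq
      field_simp)
    (by rw [dotProduct_smul, hbu, smul_zero]) (by rw [dotProduct_smul, hav, smul_zero])
  refine ⟨M, hM, ?_⟩
  rw [hs, dotProduct_smul, dotProduct_smul, hau, hbv, norm_smul, norm_smul, Complex.norm_real,
    Complex.norm_real, Complex.norm_real, Complex.norm_real, Real.norm_of_nonneg hx0,
    Real.norm_of_nonneg hy0, Real.norm_of_nonneg (by positivity),
    Real.norm_of_nonneg (by positivity), mul_pow, mul_pow y, hx2, hy2]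
  field_simp
  ring

end pureStates

/-! ### Duality between the trace norm and contractions -/

/-- `W` is a contraction for the Euclidean norm. -/
def IsContraction {n : Type*} [Fintype n] (W : Matrix n n ℂ) : Prop :=
  ∀ x y, ‖star x ⬝ᵥ (W *ᵥ y)‖ ≤ √(normSq x) * √(normSq y)

section traceNorm

variable {n : Type*} [Fintype n] [DecidableEq n]

theorem isContraction_of_posSemidef {W : Matrix n n ℂ} (hW : (1 - W * Wᴴ).PosSemidef) :
    IsContraction W := by
  intro x y
  have h : normSq (Wᴴ *ᵥ x) ≤ normSq x := by
    have := hW.re_dotProduct_nonneg x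
    rw [Matrix.sub_mulVec, dotProduct_sub, Matrix.one_mulVec, map_sub, RCLike.re_eq_complex_re,
      ← normSq_eq_re] at this
    rw [normSq_mulVec, Matrix.conjTranspose_conjTranspose]
    linarith
  calc ‖star x ⬝ᵥ (W *ᵥ y)‖ = ‖star (Wᴴ *ᵥ x) ⬝ᵥ y‖ := by
        rw [Matrix.star_mulVec, Matrix.conjTranspose_conjTranspose, Matrix.dotProduct_mulVec]
    _ ≤ √(normSq (Wᴴ *ᵥ x)) * √(normSq y) := norm_star_dotProduct_le _ _
    _ ≤ _ := by gcongr

/-- The eigenvalues lie in `{-1, 0, 1}`, so `1 - W * W` is an orthogonal projection. This suits sign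
operators of Hermitian matrices. -/
theorem isContraction_of_cube_eq {W : Matrix n n ℂ} (hW : W.IsHermitian) (h : W * W * W = W) :
    IsContraction W := by
  apply isContraction_of_posSemidef
  have : 1 - W * Wᴴ = (1 - W * W)ᴴ * (1 - W * W) := by
    rw [Matrix.conjTranspose_sub, Matrix.conjTranspose_mul, Matrix.conjTranspose_one, hW.eq,
      mul_sub, mul_one, sub_mul, ← mul_assoc (W * W), h, one_mul, sub_self, sub_zero]
  rw [this]
  exact Matrix.posSemidef_conjTranspose_mul_self _

theorem exists_unitary_diagonalization (X : Matrix n n ℂ) :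
    ∃ V ∈ Matrix.unitaryGroup n ℂ, Xᴴ * X = V * Matrix.diagonal (fun i =>
      ((Matrix.isHermitian_conjTranspose_mul_self X).eigenvalues i : ℂ)) * Vᴴ := by
  refine ⟨_, (Matrix.isHermitian_conjTranspose_mul_self X).eigenvectorUnitary.2, ?_⟩
  exact (Matrix.isHermitian_conjTranspose_mul_self X).spectral_theorem

theorem normSq_mulVec_column {X V : Matrix n n ℂ} {l : n → ℝ} (hV : V ∈ Matrix.unitaryGroup n ℂ)
    (h : Xᴴ * X = V * Matrix.diagonal (fun i => (l i : ℂ)) * Vᴴ) (j : n) :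
    normSq (X *ᵥ fun i => V i j) = l j := by
  have hV' : Vᴴ * V = 1 := Matrix.mem_unitaryGroup_iff'.1 hV
  have h2 : Vᴴ * (Xᴴ * X) * V = Matrix.diagonal (fun i => (l i : ℂ)) := by
    rw [h, ← mul_assoc, ← mul_assoc, hV', one_mul, mul_assoc, hV', mul_one]
  have h3 := congrFun (congrFun h2 j) j
  rw [Matrix.diagonal_apply_eq, mul_assoc] at h3
  rw [normSq_mulVec, ← Complex.ofReal_re (l j), ← h3]
  rfl

theorem normSq_column {V : Matrix n n ℂ} (hV : V ∈ Matrix.unitaryGroup n ℂ) (j : n) :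
    normSq (fun i => V i j) = 1 := by
  have h3 := congrFun (congrFun (Matrix.mem_unitaryGroup_iff'.1 hV) j) j
  rw [Matrix.one_apply_eq] at h3
  rw [normSq_eq_re, ← Complex.one_re, ← h3]
  rfl

/-- Taking the trace in the basis of right singular vectors, `X` sends the `j`th one to a vector
whose length is the `j`th singular value. -/
theorem re_trace_mul_le_traceNorm {W : Matrix n n ℂ} (hW : IsContraction W) (X : Matrix n n ℂ) :
    (W * X).trace.re ≤ traceNorm X := by
  obtain ⟨V, hV, h⟩ := exists_unitary_diagonalization X
  have hV' : V * Vᴴ = 1 := Matrix.mem_unitaryGroup_iff.1 hV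
  have h1 : (W * X).trace =
      ∑ j, star (fun i => V i j) ⬝ᵥ (W *ᵥ (X *ᵥ fun i => V i j)) := by
    calc (W * X).trace = (Vᴴ * (W * X * V)).trace := by
          rw [Matrix.trace_mul_comm Vᴴ, mul_assoc, hV', mul_one]
      _ = _ := by
          refine Finset.sum_congr rfl fun j _ => ?_
          rw [Matrix.mulVec_mulVec]
          rfl
  rw [h1, Complex.re_sum]
  refine Finset.sum_le_sum fun j _ => (Complex.re_le_norm _).trans ((hW _ _).trans (le_of_eq ?_))
  rw [normSq_column hV, normSq_mulVec_column hV h, Real.sqrt_one, one_mul]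

theorem exists_isContraction_trace_mul_eq (X : Matrix n n ℂ) :
    ∃ W, IsContraction W ∧ (W * X).trace.re = traceNorm X := by
  obtain ⟨V, hV, h⟩ := exists_unitary_diagonalization X
  set l := (Matrix.isHermitian_conjTranspose_mul_self X).eigenvalues with hl
  have hl0 (i : n) : 0 ≤ l i := Matrix.eigenvalues_conjTranspose_mul_self_nonneg X i
  have hV1 : V * Vᴴ = 1 := Matrix.mem_unitaryGroup_iff.1 hV
  have hV2 : Vᴴ * V = 1 := Matrix.mem_unitaryGroup_iff'.1 hV
  set R : Matrix n n ℂ := Matrix.diagonal fun i => ((√(l i))⁻¹ : ℂ) with hR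
  set L : Matrix n n ℂ := Matrix.diagonal fun i => (l i : ℂ) with hL
  have hRH : Rᴴ = R := by
    rw [hR, Matrix.diagonal_conjTranspose]
    congr 1
    ext i
    simp
  -- This is the adjoint of the partial isometry in the polar decomposition of `X`; zero singular
  -- values are dropped by `0⁻¹ = 0` in `R`.
  refine ⟨V * R * Vᴴ * Xᴴ, isContraction_of_posSemidef ?_, ?_⟩
  · have h1 : 1 - V * R * Vᴴ * Xᴴ * (V * R * Vᴴ * Xᴴ)ᴴ = V * (1 - R * L * R) * Vᴴ := by
      simp only [Matrix.conjTranspose_mul, Matrix.conjTranspose_conjTranspose, hRH]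
      calc _ = 1 - V * R * Vᴴ * (Xᴴ * X) * V * R * Vᴴ := by simp only [mul_assoc]
        _ = 1 - V * R * (Vᴴ * V) * L * (Vᴴ * V) * R * Vᴴ := by rw [h]; simp only [mul_assoc]
        _ = V * Vᴴ - V * R * L * R * Vᴴ := by rw [hV1, hV2, mul_one, mul_one]
        _ = _ := by noncomm_ring
    rw [h1]
    refine Matrix.PosSemidef.mul_mul_conjTranspose_same ?_ _
    rw [hR, hL, Matrix.diagonal_mul_diagonal, Matrix.diagonal_mul_diagonal, ← Matrix.diagonal_one,
      Matrix.diagonal_sub]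
    refine Matrix.PosSemidef.diagonal fun i => ?_
    have : (√(l i))⁻¹ * l i * (√(l i))⁻¹ ≤ 1 := by
      nth_rewrite 2 [← Real.mul_self_sqrt (hl0 i)]
      obtain h0 | h0 := eq_or_ne (√(l i)) 0
      · simp [h0]
      · apply le_of_eq
        field_simp
    rw [Pi.zero_apply, sub_nonneg]
    simpa only [Complex.ofReal_mul, Complex.ofReal_inv, Complex.ofReal_one] using
      Complex.real_le_real.2 this
  · have h1 : (V * R * Vᴴ * Xᴴ * X).trace = (R * L).trace := by
      calc _ = (V * R * Vᴴ * (Xᴴ * X)).trace := by rw [mul_assoc]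
        _ = (V * (R * (Vᴴ * V) * L * Vᴴ)).trace := by rw [h]; simp only [mul_assoc]
        _ = _ := by rw [Matrix.trace_mul_comm, hV2, mul_one, mul_assoc (R * L), hV2, mul_one]
    rw [h1, hR, hL, Matrix.diagonal_mul_diagonal, Matrix.trace_diagonal, Complex.re_sum]
    refine Finset.sum_congr rfl fun i _ => ?_
    have : (√(l i))⁻¹ * l i = √(l i) := by
      nth_rewrite 2 [← Real.mul_self_sqrt (hl0 i)]
      obtain h0 | h0 := eq_or_ne (√(l i)) 0
      · simp [h0]
      · field_simp
    rw [← hl, ← this, ← Complex.ofReal_inv, ← Complex.ofReal_mul, Complex.ofReal_re, this, this]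

/-- A balanced singular value decomposition. -/
theorem exists_eq_sum_vecMulVec (X : Matrix n n ℂ) :
    ∃ u v : n → n → ℂ, X = ∑ j, Matrix.vecMulVec (u j) (star (v j)) ∧
      ∑ j, normSq (u j) = traceNorm X ∧ ∑ j, normSq (v j) = traceNorm X := by
  obtain ⟨V, hV, h⟩ := exists_unitary_diagonalization X
  set l := (Matrix.isHermitian_conjTranspose_mul_self X).eigenvalues with hl
  have hV1 : V * Vᴴ = 1 := Matrix.mem_unitaryGroup_iff.1 hV
  have hs (j : n) : 0 ≤ √(l j) := Real.sqrt_nonneg _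
  have hl0 (j : n) : √(l j) * √(l j) = l j :=
    Real.mul_self_sqrt (Matrix.eigenvalues_conjTranspose_mul_self_nonneg X j)
  have hn (j : n) := normSq_mulVec_column hV h j
  -- The singular value `√(l j)` is split evenly between the two factors, so each has it as its
  -- squared norm.
  refine ⟨fun j => (((√√(l j))⁻¹ : ℝ) : ℂ) • (X *ᵥ fun i => V i j),
    fun j => ((√√(l j) : ℝ) : ℂ) • fun i => V i j, ?_, ?_, ?_⟩
  · have h1 : X = ∑ j, Matrix.vecMulVec (X *ᵥ fun i => V i j) (star fun i => V i j) := by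
      calc X = (X * V) * Vᴴ := by rw [mul_assoc, hV1, mul_one]
        _ = _ := by
          ext i k
          rw [Matrix.sum_apply]
          rfl
    conv_lhs => rw [h1]
    refine Finset.sum_congr rfl fun j _ => ?_
    rw [star_smul, Matrix.smul_vecMulVec, Matrix.vecMulVec_smul, smul_smul]
    obtain h0 | h0 := eq_or_ne (√√(l j)) 0
    · have : X *ᵥ (fun i => V i j) = 0 := by
        rw [← normSq_eq_zero, hn, ← hl0, (Real.sqrt_eq_zero (hs j)).1 h0, zero_mul]
      rw [this, Matrix.zero_vecMulVec, smul_zero]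
    · rw [Complex.star_def, Complex.conj_ofReal, ← Complex.ofReal_mul, inv_mul_cancel₀ h0,
        Complex.ofReal_one, one_smul]
  · refine Finset.sum_congr rfl fun j _ => ?_
    rw [normSq_smul, hn, Complex.norm_real, Real.norm_of_nonneg (by positivity), inv_pow,
      Real.sq_sqrt (hs j)]
    nth_rewrite 2 [← hl0]
    obtain h0 | h0 := eq_or_ne (√(l j)) 0
    · simp [← hl, h0]
    · rw [inv_mul_cancel_left₀ h0]
  · refine Finset.sum_congr rfl fun j _ => ?_
    rw [normSq_smul, normSq_column hV, Complex.norm_real, Real.norm_of_nonneg (by positivity),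
      Real.sq_sqrt (hs j), mul_one]

theorem traceNorm_ketbra {x : n → ℂ} (hx : star x ⬝ᵥ x = 1) : traceNorm (ketbra x) = 1 := by
  have hx' : normSq x = 1 := by rw [normSq_eq_re, hx, Complex.one_re]
  apply le_antisymm
  · obtain ⟨W, hW, h⟩ := exists_isContraction_trace_mul_eq (ketbra x)
    rw [← h, trace_mul_ketbra]
    refine (Complex.re_le_norm _).trans ((hW x x).trans ?_)
    rw [hx', Real.sqrt_one, one_mul]
  · have h1 : IsContraction (1 : Matrix n n ℂ) := fun x y => by
      rw [Matrix.one_mulVec]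
      exact norm_star_dotProduct_le x y
    have := re_trace_mul_le_traceNorm h1 (ketbra x)
    rwa [trace_mul_ketbra, Matrix.one_mulVec, hx, Complex.one_re] at this

end traceNorm

/-! ### Trace norm of a difference of two rank-one operators -/

section pairs

variable {n : Type*} [Fintype n]

theorem sqrt_mul_sqrt_add_le {p q r s : ℝ} (hp : 0 ≤ p) (hq : 0 ≤ q) (hr : 0 ≤ r) (hs : 0 ≤ s) :
    √p * √q + √r * √s ≤ √(p + r) * √(q + s) := by
  have := Real.sum_sqrt_mul_sqrt_le (Finset.univ : Finset (Fin 2)) (f := ![p, r]) (g := ![q, s])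
    (fun i => by fin_cases i <;> simpa) (fun i => by fin_cases i <;> simpa)
  simpa using this

theorem exists_norm_eq_one_mul_eq_norm (z : ℂ) : ∃ w : ℂ, ‖w‖ = 1 ∧ w * z = ‖z‖ := by
  obtain rfl | hz := eq_or_ne z 0
  · exact ⟨1, by simp⟩
  · have hz' : (‖z‖ : ℂ) ≠ 0 := by simpa using hz
    refine ⟨star z / ‖z‖, by simp [hz], ?_⟩
    rw [div_mul_eq_mul_div, Complex.star_def, Complex.conj_mul', sq, mul_div_assoc, div_self hz',
      mul_one]

/-- Upper bound on the trace norm of `|a⟩⟨a'| - |b⟩⟨b'|`. -/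
theorem IsContraction.re_sub_le {W : Matrix n n ℂ} (hW : IsContraction W) (a a' b b' : n → ℂ) :
    (star a' ⬝ᵥ (W *ᵥ a) - star b' ⬝ᵥ (W *ᵥ b)).re ≤
      √((normSq a + normSq b + (normSq a' + normSq b')) / 2 -
          ‖star a ⬝ᵥ b + star a' ⬝ᵥ b'‖) *
        √((normSq a + normSq b + (normSq a' + normSq b')) / 2 +
          ‖star a ⬝ᵥ b + star a' ⬝ᵥ b'‖) := by
  have key (b b' : n → ℂ) : (star a' ⬝ᵥ (W *ᵥ a) - star b' ⬝ᵥ (W *ᵥ b)).re ≤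
      √((normSq a + normSq b + (normSq a' + normSq b')) / 2 -
          (star a ⬝ᵥ b + star a' ⬝ᵥ b').re) *
        √((normSq a + normSq b + (normSq a' + normSq b')) / 2 +
          (star a ⬝ᵥ b + star a' ⬝ᵥ b').re) := by
    -- Polarization: the cross terms cancel, and what remains is estimated through sums and
    -- differences, whose norms contain the real part of the overlaps.
    have e1 : star a' ⬝ᵥ (W *ᵥ a) - star b' ⬝ᵥ (W *ᵥ b) =
        (star (a' - b') ⬝ᵥ (W *ᵥ (a + b)) + star (a' + b') ⬝ᵥ (W *ᵥ (a - b))) / 2 := by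
      simp only [Matrix.mulVec_add, Matrix.mulVec_sub, star_add, star_sub, add_dotProduct,
        sub_dotProduct, dotProduct_add, dotProduct_sub]
      ring
    have e2 := (Complex.re_le_norm _).trans (hW (a' - b') (a + b))
    have e3 := (Complex.re_le_norm _).trans (hW (a' + b') (a - b))
    have e4 := sqrt_mul_sqrt_add_le (normSq_nonneg (a' - b')) (normSq_nonneg (a + b))
      (normSq_nonneg (a - b)) (normSq_nonneg (a' + b'))
    have e5 : normSq (a' - b') + normSq (a - b) =
        2 * ((normSq a + normSq b + (normSq a' + normSq b')) / 2 -
          (star a ⬝ᵥ b + star a' ⬝ᵥ b').re) := by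
      rw [normSq_sub, normSq_sub, Complex.add_re]; ring
    have e6 : normSq (a + b) + normSq (a' + b') =
        2 * ((normSq a + normSq b + (normSq a' + normSq b')) / 2 +
          (star a ⬝ᵥ b + star a' ⬝ᵥ b').re) := by
      rw [normSq_add, normSq_add, Complex.add_re]; ring
    rw [e5, e6, Real.sqrt_mul zero_le_two, Real.sqrt_mul zero_le_two, mul_mul_mul_comm,
      Real.mul_self_sqrt zero_le_two] at e4
    rw [e1, Complex.div_ofNat_re, Complex.add_re]
    linarith
  -- A common phase on `b` and `b'` leaves the left side unchanged and turns the real part of the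
  -- total overlap into its modulus.
  obtain ⟨w, hw, hwz⟩ := exists_norm_eq_one_mul_eq_norm (star a ⬝ᵥ b + star a' ⬝ᵥ b')
  have hww : star w * w = 1 := by
    rw [Complex.star_def, Complex.conj_mul', hw]; simp
  have := key (w • b) (w • b')
  rwa [normSq_smul, normSq_smul, hw, one_pow, one_mul, one_mul, dotProduct_smul, dotProduct_smul,
    ← smul_add, smul_eq_mul, hwz, Complex.ofReal_re, star_smul, smul_dotProduct, Matrix.mulVec_smul,
    dotProduct_smul, smul_smul, hww, one_smul] at this

variable [DecidableEq n]

/-- The trace norm of `|a⟩⟨a| - |b⟩⟨b|` for vectors that are orthogonal or of equal length. -/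
theorem exists_isContraction_sqrt_le {a b : n → ℂ}
    (h : normSq a = normSq b ∨ star a ⬝ᵥ b = 0) :
    ∃ W, IsContraction W ∧ √((normSq a + normSq b) ^ 2 - 4 * ‖star a ⬝ᵥ b‖ ^ 2) ≤
      (star a ⬝ᵥ (W *ᵥ a) - star b ⬝ᵥ (W *ᵥ b)).re := by
  set A := normSq a
  set B := normSq b
  set c := ‖star a ⬝ᵥ b‖ with hc
  have hA0 : 0 ≤ A := normSq_nonneg a
  have hB0 : 0 ≤ B := normSq_nonneg b
  have hcAB : c ≤ (A + B) / 2 := norm_star_dotProduct_le_half a b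
  have hba : ‖star b ⬝ᵥ a‖ = c := by rw [star_dotProduct_comm a b, norm_star]
  have haa : ‖star a ⬝ᵥ a‖ = A := by
    rw [star_dotProduct_self, Complex.norm_real, Real.norm_of_nonneg hA0]
  have hbb : ‖star b ⬝ᵥ b‖ = B := by
    rw [star_dotProduct_self, Complex.norm_real, Real.norm_of_nonneg hB0]
  have mul (u v : n → ℂ) : ketbra u * ketbra v = (star u ⬝ᵥ v) • Matrix.vecMulVec u (star v) := by
    rw [ketbra, ketbra, Matrix.vecMulVec_mul_vecMulVec, Matrix.vecMulVec_smul]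
  have mul_self (u : n → ℂ) : ketbra u * ketbra u = (normSq u : ℂ) • ketbra u := by
    rw [mul, star_dotProduct_self]; rfl
  have mul_mul (u v : n → ℂ) :
      ketbra u * ketbra v * ketbra u = ((‖star u ⬝ᵥ v‖ ^ 2 : ℝ) : ℂ) • ketbra u := by
    rw [mul, ketbra, Matrix.smul_mul, Matrix.vecMulVec_mul_vecMulVec, Matrix.vecMulVec_smul,
      smul_smul, star_dotProduct_comm u v, Complex.star_def, Complex.mul_conj', Complex.ofReal_pow]
  have herm (s t : ℝ) : ((s : ℂ) • ketbra a - (t : ℂ) • ketbra b).IsHermitian := by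
    have h (s : ℝ) (u : n → ℂ) : ((s : ℂ) • ketbra u).IsHermitian := by
      rw [Matrix.IsHermitian, Matrix.conjTranspose_smul, (ketbra_posSemidef u).1.eq,
        Complex.star_def, Complex.conj_ofReal]
    exact (h s a).sub (h t b)
  have value (s t : ℝ) : (star a ⬝ᵥ (((s : ℂ) • ketbra a - (t : ℂ) • ketbra b) *ᵥ a) -
      star b ⬝ᵥ (((s : ℂ) • ketbra a - (t : ℂ) • ketbra b) *ᵥ b)).re =
      s * (A ^ 2 - c ^ 2) + t * (B ^ 2 - c ^ 2) := by
    simp only [Matrix.sub_mulVec, Matrix.smul_mulVec, dotProduct_sub, dotProduct_smul,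
      star_dotProduct_ketbra_mulVec, haa, hbb, hba, ← hc, smul_eq_mul, Complex.sub_re,
      Complex.re_ofReal_mul, Complex.ofReal_re]
    ring
  obtain h | h := h
  · set r := √(A ^ 2 - c ^ 2)
    have hr2 : r * r = A ^ 2 - c ^ 2 := Real.mul_self_sqrt (by nlinarith [norm_nonneg (star a ⬝ᵥ b)])
    -- For equal lengths the difference `K` of the projectors has trace zero and `K³ = r² K`, so its
    -- sign operator is `K / r`.
    refine ⟨((r⁻¹ : ℝ) : ℂ) • ketbra a - ((r⁻¹ : ℝ) : ℂ) • ketbra b,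
      isContraction_of_cube_eq (herm _ _) ?_, ?_⟩
    · have e1 : ketbra a * ketbra a = (A : ℂ) • ketbra a := mul_self a
      have e2 : ketbra b * ketbra b = (A : ℂ) • ketbra b := by rw [mul_self b, h]
      have e3 : ketbra a * ketbra b * ketbra a = ((c ^ 2 : ℝ) : ℂ) • ketbra a := mul_mul a b
      have e4 : ketbra b * ketbra a * ketbra b = ((c ^ 2 : ℝ) : ℂ) • ketbra b := by
        rw [mul_mul b a, hba]
      have e5 : ketbra a * ketbra b * ketbra b = (A : ℂ) • (ketbra a * ketbra b) := by
        rw [mul_assoc, e2, Matrix.mul_smul]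
      have e6 : ketbra b * ketbra a * ketbra a = (A : ℂ) • (ketbra b * ketbra a) := by
        rw [mul_assoc, e1, Matrix.mul_smul]
      have e7 : (ketbra a - ketbra b) * (ketbra a - ketbra b) * (ketbra a - ketbra b) =
          ((r * r : ℝ) : ℂ) • (ketbra a - ketbra b) := by
        simp only [sub_mul, mul_sub, e1, e2, e3, e4, e5, e6, Matrix.smul_mul, hr2]
        push_cast
        module
      rw [← smul_sub]
      simp only [Matrix.smul_mul, Matrix.mul_smul, e7, smul_smul]
      congr 1
      norm_cast
      obtain h0 | h0 := eq_or_ne r 0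
      · simp [h0]
      · field_simp
    · rw [value, ← h, ← hr2]
      have h4 : (A + A) ^ 2 - 4 * c ^ 2 = (2 * r) ^ 2 := by rw [mul_pow, sq r, hr2]; ring
      rw [h4, Real.sqrt_sq (by positivity)]
      obtain h0 | h0 := eq_or_ne r 0
      · simp [h0]
      · rw [inv_mul_cancel_left₀ h0]; linarith
  · have hc0 : c = 0 := by rw [hc, h, norm_zero]
    -- For orthogonal vectors the sign operator is the difference of the normalized projections.
    refine ⟨((A⁻¹ : ℝ) : ℂ) • ketbra a - ((B⁻¹ : ℝ) : ℂ) • ketbra b,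
      isContraction_of_cube_eq (herm _ _) ?_, ?_⟩
    · have e1 : ketbra a * ketbra a = (A : ℂ) • ketbra a := mul_self a
      have e2 : ketbra b * ketbra b = (B : ℂ) • ketbra b := mul_self b
      have e3 : ketbra a * ketbra b = 0 := by rw [mul, h, zero_smul]
      have e4 : ketbra b * ketbra a = 0 := by
        rw [mul, star_dotProduct_comm a b, h, star_zero, zero_smul]
      simp only [sub_mul, mul_sub, add_mul, Matrix.smul_mul, Matrix.mul_smul, e1, e2, e3, e4,
        smul_zero, smul_smul, sub_zero, zero_sub, sub_neg_eq_add, zero_add, add_zero]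
      congr 2
      · obtain h0 | h0 := eq_or_ne A 0
        · simp [h0]
        · norm_cast
          field_simp
      · obtain h0 | h0 := eq_or_ne B 0
        · simp [h0]
        · norm_cast
          field_simp
    · rw [value, hc0]
      have hi (x : ℝ) : x⁻¹ * (x ^ 2 - 0 ^ 2) = x := by
        obtain h0 | h0 := eq_or_ne x 0
        · simp [h0]
        · field_simp; ring
      rw [hi, hi]
      simp [Real.sqrt_sq (add_nonneg hA0 hB0)]

end pairs

/-! ### The minimization over density matrices and its dual -/

section saddlePoint

variable {n : Type*} [Fintype n]

theorem exists_isDensity_smul_eq [Nonempty n] {ρ : Matrix n n ℂ} (hρ : ρ.PosSemidef) :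
    ∃ ρ', IsDensity ρ' ∧ ρ = (ρ.trace.re : ℂ) • ρ' := by
  classical
  rw [hρ.ofReal_re_trace]
  obtain h | h := eq_or_ne ρ.trace 0
  · let i : n := Classical.arbitrary n
    refine ⟨ketbra (Pi.single i 1), ketbra_isDensity (by simp), ?_⟩
    rw [h, zero_smul, hρ.trace_eq_zero_iff.1 h]
  · refine ⟨ρ.trace⁻¹ • ρ, ⟨hρ.smul (inv_nonneg.2 hρ.trace_nonneg), ?_⟩, ?_⟩
    · rw [Matrix.trace_smul, smul_eq_mul, inv_mul_cancel₀ h]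
    · rw [smul_smul, mul_inv_cancel₀ h, one_smul]

theorem mul_re_trace_le_sum_norm [Nonempty n] {U₁ U₂ : Matrix n n ℂ} {m : ℝ}
    (h : ∀ ρ : Matrix n n ℂ, IsDensity ρ → m ≤ ∑ i, ‖(U₁ * ρ * U₂) i i‖) {ρ : Matrix n n ℂ} (hρ : ρ.PosSemidef) :
    m * ρ.trace.re ≤ ∑ i, ‖(U₁ * ρ * U₂) i i‖ := by
  obtain ⟨ρ', h1, h2⟩ := exists_isDensity_smul_eq hρ
  have h0 : 0 ≤ ρ.trace.re := (Complex.nonneg_iff.1 hρ.trace_nonneg).1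
  rw [h2]
  simp only [Matrix.mul_smul, Matrix.smul_mul, Matrix.smul_apply, smul_eq_mul, norm_mul,
    ← Finset.mul_sum, Complex.norm_real, Real.norm_of_nonneg h0, Matrix.trace_smul, h1.2, mul_one,
    Complex.ofReal_re]
  rw [mul_comm]
  exact mul_le_mul_of_nonneg_left (h _ h1) h0

theorem convex_setOf_isDensity : Convex ℝ {ρ : Matrix n n ℂ | IsDensity ρ} := by
  rintro ρ ⟨h1, h2⟩ σ ⟨h3, h4⟩ s t hs ht hst
  refine ⟨(h1.smul hs).add (h3.smul ht), ?_⟩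
  rw [Matrix.trace_add, Matrix.trace_smul, Matrix.trace_smul, h2, h4, Complex.real_smul,
    Complex.real_smul, mul_one, mul_one, ← Complex.ofReal_add, hst, Complex.ofReal_one]

variable [DecidableEq n]

theorem trace_mul_diagonal (A : Matrix n n ℂ) (E : n → ℂ) :
    (A * Matrix.diagonal E).trace = ∑ i, A i i * E i := by
  simp [Matrix.trace]

omit [DecidableEq n] in
theorem exists_isMinOn_sum_norm [Nonempty n] (U : Matrix n n ℂ) :
    ∃ ρ : Matrix n n ℂ, IsDensity ρ ∧
      ∀ σ : Matrix n n ℂ, IsDensity σ → ∑ i, ‖(ρ * U) i i‖ ≤ ∑ i, ‖(σ * U) i i‖ := by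
  have hne : {ρ : Matrix n n ℂ | IsDensity ρ}.Nonempty := by
    obtain ⟨ρ, h, -⟩ := exists_isDensity_smul_eq (n := n) Matrix.PosSemidef.zero
    exact ⟨ρ, h⟩
  obtain ⟨ρ, h1, h2⟩ := isCompact_setOf_isDensity.exists_isMinOn hne
    (f := fun ρ : Matrix n n ℂ => ∑ i, ‖(ρ * U) i i‖) (by fun_prop)
  exact ⟨ρ, h1, fun σ hσ => h2 hσ⟩

/-- A dual witness for the minimum of `∑ i, ‖(ρ * U) i i‖` over the density matrices. -/
theorem exists_diagonal_le_re_trace [Nonempty n] {U : Matrix n n ℂ} {m : ℝ} (hm : 0 < m)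
    (h : ∀ ρ : Matrix n n ℂ, IsDensity ρ → m ≤ ∑ i, ‖(ρ * U) i i‖) :
    ∃ E : n → ℂ, (∀ i, ‖E i‖ ≤ 1) ∧
      ∀ ρ, IsDensity ρ → m ≤ (ρ * (U * Matrix.diagonal E)).trace.re := by
  let s : Set (n → ℂ) := {c | ∑ i, ‖c i‖ < m}
  let t : Set (n → ℂ) := (fun ρ : Matrix n n ℂ => fun i => (ρ * U) i i) '' {ρ | IsDensity ρ}
  have hs1 : Convex ℝ s := by
    have : ConvexOn ℝ Set.univ fun c : n → ℂ => ∑ i, ‖c i‖ := by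
      refine ⟨convex_univ, fun x _ y _ a b ha hb _ => ?_⟩
      rw [smul_eq_mul, smul_eq_mul, Finset.mul_sum, Finset.mul_sum, ← Finset.sum_add_distrib]
      refine Finset.sum_le_sum fun i _ => (norm_add_le _ _).trans (le_of_eq ?_)
      simp [abs_of_nonneg ha, abs_of_nonneg hb]
    simpa [s] using this.convex_lt m
  have hs2 : IsOpen s := isOpen_lt (by fun_prop) continuous_const
  have ht : Convex ℝ t := by
    refine convex_setOf_isDensity.is_linear_image (f := fun ρ : Matrix n n ℂ => fun i => (ρ * U) i i)
      ⟨fun x y => ?_, fun c x => ?_⟩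
    · ext i; simp [Matrix.add_mul]
    · ext i; simp
  -- Every point of `t` has ℓ¹ norm at least `m`, so it misses the open ball of radius `m`. The
  -- separating functional, rescaled by `m / u`, becomes a dual vector of ℓ∞ norm at most one.
  have hd : Disjoint s t := by
    rw [Set.disjoint_left]
    rintro _ hc ⟨ρ, hρ, rfl⟩
    exact (h ρ hρ).not_gt hc
  obtain ⟨f, u, hf1, hf2⟩ := RCLike.geometric_hahn_banach_open (𝕜 := ℂ) hs1 hs2 ht hd
  have hu : 0 < u := by simpa using hf1 0 (by simpa [s] using hm)
  have hf (c : n → ℂ) : f c = ∑ i, c i * f (Pi.single i 1) := by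
    conv_lhs => rw [pi_eq_sum_univ' c]
    simp
  refine ⟨fun i => ((m / u : ℝ) : ℂ) * f (Pi.single i 1), fun i => ?_, fun ρ hρ => ?_⟩
  · by_contra! hi
    obtain ⟨w, hw, hwz⟩ := exists_norm_eq_one_mul_eq_norm (f (Pi.single i 1))
    rw [norm_mul, Complex.norm_real, Real.norm_of_nonneg (by positivity), div_mul_eq_mul_div,
      one_lt_div hu] at hi
    set F := ‖f (Pi.single i 1)‖
    have hF : 0 < F := by
      by_contra! hF
      nlinarith
    -- If `‖E i‖ > 1`, this vector lies in the ball, since `u / F < m`, yet `f` takes the value `u`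
    -- on it.
    have h3 := hf1 (Pi.single i (((u / F : ℝ) : ℂ) * w)) (by
      have : ∀ j, ‖(Pi.single i (((u / F : ℝ) : ℂ) * w) : n → ℂ) j‖ =
          if j = i then u / F else 0 := by
        intro j
        obtain rfl | hj := eq_or_ne j i
        · simp [hw, abs_of_pos hu, abs_of_pos hF]
        · simp [hj]
      simp only [s, Set.mem_ofPred_eq, this, Finset.sum_ite_eq', Finset.mem_univ, if_true]
      rwa [div_lt_iff₀ hF])
    rw [hf, Finset.sum_eq_single i (fun j _ hj => by simp [hj]) (by simp), Pi.single_eq_same,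
      mul_assoc, hwz, ← Complex.ofReal_mul, div_mul_cancel₀ _ hF.ne', RCLike.re_eq_complex_re,
      Complex.ofReal_re] at h3
    exact lt_irrefl _ h3
  · have h3 := hf2 _ ⟨ρ, hρ, rfl⟩
    have h4 : (ρ * (U * Matrix.diagonal fun i => ((m / u : ℝ) : ℂ) * f (Pi.single i 1))).trace =
        ((m / u : ℝ) : ℂ) * f fun i => (ρ * U) i i := by
      rw [← mul_assoc, trace_mul_diagonal, hf, Finset.mul_sum]
      exact Finset.sum_congr rfl fun i _ => by ring
    rw [h4, Complex.re_ofReal_mul, div_mul_eq_mul_div, le_div_iff₀ hu]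
    exact mul_le_mul_of_nonneg_left h3 hm.le

theorem posSemidef_add_conjTranspose_sub [Nonempty n] {V : Matrix n n ℂ} {m : ℝ}
    (h : ∀ ρ, IsDensity ρ → m ≤ (ρ * V).trace.re) :
    (V + Vᴴ - ((2 * m : ℝ) : ℂ) • 1).PosSemidef := by
  refine .of_dotProduct_mulVec_nonneg ?_ fun x => ?_
  · rw [Matrix.IsHermitian, Matrix.conjTranspose_sub, Matrix.conjTranspose_add,
      Matrix.conjTranspose_smul, Matrix.conjTranspose_conjTranspose, Matrix.conjTranspose_one,
      Complex.star_def, Complex.conj_ofReal, add_comm]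
  · obtain ⟨ρ, h1, h2⟩ := exists_isDensity_smul_eq (ketbra_posSemidef x)
    have hx : (ketbra x).trace.re = normSq x := by
      rw [ketbra, Matrix.trace_vecMulVec, dotProduct_comm, normSq_eq_re]
    have h3 : normSq x * m ≤ (star x ⬝ᵥ (V *ᵥ x)).re := by
      rw [← trace_mul_ketbra, h2, hx, Matrix.mul_smul, Matrix.trace_smul, smul_eq_mul,
        Complex.re_ofReal_mul, Matrix.trace_mul_comm]
      exact mul_le_mul_of_nonneg_left (h ρ h1) (normSq_nonneg x)
    have h4 : star x ⬝ᵥ (Vᴴ *ᵥ x) = star (star x ⬝ᵥ (V *ᵥ x)) := by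
      rw [← star_dotProduct_comm, Matrix.dotProduct_mulVec, ← Matrix.star_mulVec]
    rw [Matrix.sub_mulVec, Matrix.add_mulVec, Matrix.smul_mulVec, Matrix.one_mulVec,
      dotProduct_sub, dotProduct_add, h4, dotProduct_smul, star_dotProduct_self, Complex.star_def,
      Complex.add_conj, smul_eq_mul, ← Complex.ofReal_mul, ← Complex.ofReal_sub,
      Complex.zero_le_real]
    linarith

theorem trace_diagonal_mul (A : Matrix n n ℂ) (E : n → ℂ) :
    (Matrix.diagonal E * A).trace = ∑ i, E i * A i i := by
  simp [Matrix.trace]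

theorem sum_norm_mul_unitary_le {U ρ : Matrix n n ℂ} (hU : U ∈ Matrix.unitaryGroup n ℂ)
    (hρ : IsDensity ρ) : ∑ i, ‖(ρ * U) i i‖ ≤ 1 := by
  have h1 (i : n) : ‖(ρ * U) i i‖ ≤ ((ρ i i).re + ((Uᴴ * ρ * U) i i).re) / 2 := by
    have := hρ.1.norm_star_dotProduct_mulVec_le (Pi.single i 1) (fun j => U j i)
    have e1 : star (Pi.single i 1) ⬝ᵥ (ρ *ᵥ fun j => U j i) = (ρ * U) i i := by
      rw [← Pi.single_star, star_one, single_one_dotProduct]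
      rfl
    have e2 : star (Pi.single i 1) ⬝ᵥ (ρ *ᵥ Pi.single i 1) = ρ i i := by
      simp
    have e3 : star (fun j => U j i) ⬝ᵥ (ρ *ᵥ fun j => U j i) = (Uᴴ * ρ * U) i i := by
      rw [mul_assoc]
      rfl
    rwa [e1, e2, e3] at this
  have h2 : ∑ i, (ρ i i).re = 1 := by
    have := congrArg Complex.re hρ.2
    rwa [Matrix.trace, Complex.re_sum, Complex.one_re] at this
  have h3 : ∑ i, ((Uᴴ * ρ * U) i i).re = 1 := by
    have : (Uᴴ * ρ * U).trace = 1 := by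
      rw [Matrix.trace_mul_comm, ← mul_assoc, ← Matrix.star_eq_conjTranspose,
        Matrix.mem_unitaryGroup_iff.1 hU, one_mul, hρ.2]
    have := congrArg Complex.re this
    rwa [Matrix.trace, Complex.re_sum, Complex.one_re] at this
  calc _ ≤ ∑ i, ((ρ i i).re + ((Uᴴ * ρ * U) i i).re) / 2 := Finset.sum_le_sum fun i _ => h1 i
    _ = 1 := by rw [← Finset.sum_div, Finset.sum_add_distrib, h2, h3]; norm_num

end saddlePoint

/-! ### Complementary slackness and a unimodular dual witness -/

section saddlePoint

variable {n : Type*} [Fintype n] [DecidableEq n]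

-- The equality case of `Re (z i * w i) ≤ ‖z i‖`, forced in every term by equality of the sums.
omit [DecidableEq n] in
theorem mul_eq_norm_of_sum_norm_le {z w : n → ℂ} (hw : ∀ i, ‖w i‖ ≤ 1)
    (h : ∑ i, ‖z i‖ ≤ (∑ i, z i * w i).re) (i : n) : z i * w i = ‖z i‖ := by
  have h1 (i : n) : ‖z i * w i‖ ≤ ‖z i‖ := by
    rw [norm_mul]
    exact mul_le_of_le_one_right (norm_nonneg _) (hw i)
  have h2 (i : n) : (z i * w i).re ≤ ‖z i‖ := (Complex.re_le_norm _).trans (h1 i)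
  rw [Complex.re_sum] at h
  have h3 : (z i * w i).re = ‖z i‖ := by
    have := (Finset.sum_eq_sum_iff_of_le fun i _ => h2 i).1
      (le_antisymm (Finset.sum_le_sum fun i _ => h2 i) h)
    exact this i (Finset.mem_univ i)
  have h4 : (z i * w i).re = ‖z i * w i‖ := le_antisymm (Complex.re_le_norm _) (h3 ▸ h1 i)
  rw [← h3]
  exact Complex.ext rfl (Complex.nonneg_iff.1 (Complex.re_eq_norm.1 h4)).2.symm

/-- At a saddle point the diagonal dual witness may be chosen unitary. -/
theorem exists_unitary_eigenvalue_eq [Nonempty n] {U ρ : Matrix n n ℂ} {m : ℝ}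
    (hU : U ∈ Matrix.unitaryGroup n ℂ) (hm : 0 < m)
    (h : ∀ ρ : Matrix n n ℂ, IsDensity ρ → m ≤ ∑ i, ‖(ρ * U) i i‖) (hρ : IsDensity ρ)
    (hρm : ∑ i, ‖(ρ * U) i i‖ = m) :
    ∃ E : n → ℂ, (∀ i, ‖E i‖ = 1) ∧
      (U * Matrix.diagonal E) * ρ + (U * Matrix.diagonal E)ᴴ * ρ = ((2 * m : ℝ) : ℂ) • ρ ∧
      ∀ i, (ρ * U) i i * E i = ‖(ρ * U) i i‖ := by
  have hU1 : U * Uᴴ = 1 := Matrix.mem_unitaryGroup_iff.1 hU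
  have hU2 : Uᴴ * U = 1 := Matrix.mem_unitaryGroup_iff'.1 hU
  obtain ⟨E, hE, hEm⟩ := exists_diagonal_le_re_trace hm h
  obtain ⟨V, hV⟩ : ∃ V, V = U * Matrix.diagonal E := ⟨_, rfl⟩
  rw [← hV] at hEm
  set Q : Matrix n n ℂ := Matrix.diagonal fun i => ((‖E i‖ ^ 2 : ℝ) : ℂ) with hQ
  have hH := posSemidef_add_conjTranspose_sub hEm
  set H := V + Vᴴ - ((2 * m : ℝ) : ℂ) • 1 with hHdef
  have hc (i : n) : (ρ * U) i i * E i = ‖(ρ * U) i i‖ := by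
    refine mul_eq_norm_of_sum_norm_le (z := fun i => (ρ * U) i i) hE ?_ i
    rw [hρm, ← trace_mul_diagonal, mul_assoc, ← hV]
    exact hEm ρ hρ
  have hc1 (i : n) : (ρ * V) i i = ‖(ρ * U) i i‖ := by
    rw [hV, ← mul_assoc, Matrix.mul_diagonal, hc]
  have hρH : ρᴴ = ρ := hρ.1.1
  have hVρ : (ρ * V)ᴴ = Vᴴ * ρ := by rw [Matrix.conjTranspose_mul, hρH]
  have hc2 (i : n) : (Vᴴ * ρ) i i = ‖(ρ * U) i i‖ := by
    rw [← hVρ, Matrix.conjTranspose_apply, hc1, Complex.star_def, Complex.conj_ofReal]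
  have htr : (ρ * V).trace = m := by
    rw [← hρm]
    push_cast
    exact Finset.sum_congr rfl fun i _ => hc1 i
  have htr' : (Vᴴ * ρ).trace = m := by
    rw [← hρm]
    push_cast
    exact Finset.sum_congr rfl fun i _ => hc2 i
  -- Where the diagonal entry is nonzero, `E i` is already unimodular; hence inserting `Q` does not
  -- change the traces below.
  have hcE (i : n) : ((‖E i‖ ^ 2 : ℝ) : ℂ) * ‖(ρ * U) i i‖ = ‖(ρ * U) i i‖ := by
    have h1 := congrArg norm (hc i)
    rw [norm_mul, Complex.norm_real, norm_norm] at h1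
    obtain h0 | h0 := eq_or_ne ‖(ρ * U) i i‖ 0
    · simp [h0]
    · have : ‖E i‖ = 1 := by
        have : ‖(ρ * U) i i‖ * ‖E i‖ = ‖(ρ * U) i i‖ * 1 := by rw [h1, mul_one]
        exact mul_left_cancel₀ h0 this
      simp [this]
  have hQ1 : (Q * (Vᴴ * ρ)).trace = m := by
    rw [hQ, trace_diagonal_mul, ← htr']
    exact Finset.sum_congr rfl fun i _ => by rw [hc2, hcE, Matrix.diag_apply, hc2]
  have hQ2 : (ρ * V * Q).trace = m := by
    rw [hQ, trace_mul_diagonal, ← htr]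
    exact Finset.sum_congr rfl fun i _ => by rw [hc1, mul_comm, hcE, Matrix.diag_apply, hc1]
  have hHρ : H * ρ = 0 := by
    apply hH.mul_eq_zero_of_trace_mul_eq_zero hρ.1
    rw [hHdef, Matrix.sub_mul, Matrix.add_mul, Matrix.smul_mul, one_mul, Matrix.trace_sub,
      Matrix.trace_add, Matrix.trace_smul, htr', Matrix.trace_mul_comm, htr, hρ.2, smul_eq_mul]
    push_cast
    ring
  have hρH' : ρ * H = 0 := by
    rw [← Matrix.conjTranspose_eq_zero, Matrix.conjTranspose_mul, hρH, hH.1.eq, hHρ]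
  have e1 : V * ρ + Vᴴ * ρ = ((2 * m : ℝ) : ℂ) • ρ := by
    rw [← sub_eq_zero, ← hHρ, hHdef, Matrix.sub_mul, Matrix.add_mul, Matrix.smul_mul, one_mul]
  have e2 : ρ * V + ρ * Vᴴ = ((2 * m : ℝ) : ℂ) • ρ := by
    rw [← sub_eq_zero, ← hρH', hHdef, Matrix.mul_sub, Matrix.mul_add, Matrix.mul_smul, mul_one]
  have hVV : Vᴴ * V = Q := by
    rw [hV, Matrix.conjTranspose_mul, mul_assoc, ← mul_assoc Uᴴ, hU2, one_mul,
      Matrix.diagonal_conjTranspose, Matrix.diagonal_mul_diagonal, hQ]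
    congr 1
    ext i
    simp [Complex.conj_mul']
  have hVV' : V * Vᴴ = U * Q * Uᴴ := by
    rw [hV, Matrix.conjTranspose_mul, ← mul_assoc, mul_assoc U,
      Matrix.diagonal_conjTranspose, Matrix.diagonal_mul_diagonal, hQ]
    congr 3
    ext i
    simp [Complex.mul_conj']
  have hP : (1 - Q).PosSemidef := by
    rw [hQ, ← Matrix.diagonal_one, Matrix.diagonal_sub]
    refine Matrix.PosSemidef.diagonal fun i => ?_
    have : ‖E i‖ ^ 2 ≤ 1 := pow_le_one₀ (norm_nonneg _) (hE i)
    rw [Pi.zero_apply, ← Complex.ofReal_one, ← Complex.ofReal_sub, Complex.zero_le_real]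
    linarith
  have e1' : V * ρ = ((2 * m : ℝ) : ℂ) • ρ - Vᴴ * ρ := by rw [← e1, add_sub_cancel_right]
  have e1'' : Vᴴ * ρ = ((2 * m : ℝ) : ℂ) • ρ - V * ρ := by rw [← e1, add_sub_cancel_left]
  have e2' : ρ * V = ((2 * m : ℝ) : ℂ) • ρ - ρ * Vᴴ := by rw [← e2, add_sub_cancel_right]
  have e2'' : ρ * Vᴴ = ((2 * m : ℝ) : ℂ) • ρ - ρ * V := by rw [← e2, add_sub_cancel_left]
  -- With `t = tr X` the hypothesis reads `0 ≤ 2 m (t - 1)`, and `m > 0`.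
  have bound (X : Matrix n n ℂ) (hX : X.PosSemidef)
      (h2 : 0 ≤ 2 * (((2 * m : ℝ) : ℂ) * X.trace - m) - ((2 * m : ℝ) : ℂ) * X.trace) :
      1 ≤ X.trace := by
    rw [← hX.ofReal_re_trace] at h2 ⊢
    have h3 : 0 ≤ 2 * (2 * m * X.trace.re - m) - 2 * m * X.trace.re := by exact_mod_cast h2
    have h4 : 1 ≤ X.trace.re := by nlinarith
    exact_mod_cast h4
  have zero (X : Matrix n n ℂ) (hX : X.PosSemidef) (hX1 : X.trace = 1)
      (h2 : 1 ≤ (Q * X).trace) : (1 - Q) * X = 0 := by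
    apply hP.mul_eq_zero_of_trace_mul_eq_zero hX
    refine le_antisymm ?_ (hP.trace_mul_nonneg hX)
    rw [Matrix.sub_mul, one_mul, Matrix.trace_sub, hX1]
    exact sub_nonpos.2 h2
  -- Testing `H ≥ 0` against `V * ρ * Vᴴ` and eliminating with the eigenvalue relation gives `tr (Q
  -- ρ) ≥ 1`; since `Q ≤ 1`, slackness applies. The same argument with `Vᴴ * ρ * V` yields `hz2`.
  have hz1 : (1 - Q) * ρ = 0 := by
    refine zero ρ hρ.1 hρ.2 ?_
    have hq : (Q * ρ).trace = (V * ρ * Vᴴ).trace := by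
      rw [← hVV, mul_assoc, Matrix.trace_mul_comm]
    rw [hq]
    refine bound _ (hρ.1.mul_mul_conjTranspose_same V) ?_
    have h1 := (hH.conjTranspose_mul_mul_same V).trace_mul_nonneg hρ.1
    have h2 : (Vᴴ * H * V * ρ).trace =
        (Q * (V * ρ)).trace + (Q * (ρ * Vᴴ)).trace - ((2 * m : ℝ) : ℂ) * (Q * ρ).trace := by
      have h3 : Vᴴ * H * V = Q * V + Vᴴ * Q - ((2 * m : ℝ) : ℂ) • Q := by
        rw [← hVV, hHdef]
        simp only [Matrix.mul_sub, Matrix.sub_mul, Matrix.mul_add, Matrix.add_mul, Matrix.mul_smul,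
          Matrix.smul_mul, mul_one, mul_assoc]
      rw [h3, Matrix.sub_mul, Matrix.add_mul, Matrix.smul_mul, Matrix.trace_sub, Matrix.trace_add,
        Matrix.trace_smul, smul_eq_mul, mul_assoc, mul_assoc Vᴴ, Matrix.trace_mul_comm Vᴴ,
        mul_assoc Q ρ]
    have h4 : (Q * (ρ * V)).trace = m := by rw [Matrix.trace_mul_comm, hQ2]
    rw [h2, e1', e2'', Matrix.mul_sub, Matrix.mul_sub, Matrix.mul_smul, Matrix.trace_sub,
      Matrix.trace_sub, Matrix.trace_smul, hQ1, h4, smul_eq_mul] at h1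
    rw [← hq]
    linear_combination h1
  have hz2 : (1 - Q) * (Uᴴ * ρ * U) = 0 := by
    refine zero _ (hρ.1.conjTranspose_mul_mul_same U) ?_ ?_
    · rw [Matrix.trace_mul_comm, ← mul_assoc, hU1, one_mul, hρ.2]
    have hq : (Q * (Uᴴ * ρ * U)).trace = (Vᴴ * ρ * V).trace := by
      rw [mul_assoc Vᴴ, Matrix.trace_mul_comm Vᴴ, mul_assoc ρ, hVV', Matrix.trace_mul_comm ρ,
        ← mul_assoc, ← mul_assoc, Matrix.trace_mul_comm (Q * Uᴴ * ρ)]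
      simp only [mul_assoc]
    have hq' : (V * Vᴴ * ρ).trace = (Vᴴ * ρ * V).trace := by
      rw [mul_assoc, Matrix.trace_mul_comm]
    rw [hq]
    refine bound _ (hρ.1.conjTranspose_mul_mul_same V) ?_
    have h1 := (hH.mul_mul_conjTranspose_same V).trace_mul_nonneg hρ.1
    have h2 : (V * H * Vᴴ * ρ).trace = (V * Vᴴ * (ρ * V)).trace + (V * Vᴴ * (Vᴴ * ρ)).trace -
        ((2 * m : ℝ) : ℂ) * (V * Vᴴ * ρ).trace := by
      have h3 : V * H * Vᴴ = V * (V * Vᴴ) + V * Vᴴ * Vᴴ - ((2 * m : ℝ) : ℂ) • (V * Vᴴ) := by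
        rw [hHdef]
        simp only [Matrix.mul_sub, Matrix.sub_mul, Matrix.mul_add, Matrix.add_mul, Matrix.mul_smul,
          Matrix.smul_mul, mul_one, mul_assoc]
      rw [h3, Matrix.sub_mul, Matrix.add_mul, Matrix.smul_mul, Matrix.trace_sub, Matrix.trace_add,
        Matrix.trace_smul, smul_eq_mul, mul_assoc V, Matrix.trace_mul_comm V, mul_assoc (V * Vᴴ) ρ,
        mul_assoc (V * Vᴴ) Vᴴ]
    have h4 : (V * Vᴴ * (ρ * Vᴴ)).trace = m := by
      rw [← hQ1, ← hVV, ← mul_assoc, Matrix.trace_mul_comm]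
      simp only [mul_assoc]
    have h5 : (V * Vᴴ * (V * ρ)).trace = m := by
      rw [← hQ2, ← hVV, mul_assoc ρ, Matrix.trace_mul_comm ρ]
      simp only [mul_assoc]
    rw [h2, e1'', e2', Matrix.mul_sub, Matrix.mul_sub, Matrix.mul_smul, Matrix.trace_sub,
      Matrix.trace_sub, Matrix.trace_smul, h4, h5, smul_eq_mul, hq'] at h1
    linear_combination h1
  -- Rows with `‖E i‖ ≠ 1` vanish in both `ρ` and `Uᴴ * ρ * U`, so those entries of `E` may be
  -- replaced by any phase. The first is used for `V * ρ`, the second for `Vᴴ * ρ`.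
  set E' : n → ℂ := fun i => if ‖E i‖ = 1 then E i else 1 with hE'
  have hne (i : n) (hi : ‖E i‖ ≠ 1) : (1 - ((‖E i‖ ^ 2 : ℝ) : ℂ)) ≠ 0 := by
    intro h0
    rw [sub_eq_zero, eq_comm] at h0
    have : ‖E i‖ ^ 2 = 1 := by exact_mod_cast h0
    exact hi ((pow_eq_one_iff_of_nonneg (norm_nonneg _) two_ne_zero).1 this)
  have hrow (X : Matrix n n ℂ) (hX : (1 - Q) * X = 0) (i j : n) (hi : ‖E i‖ ≠ 1) : X i j = 0 := by
    have := congrFun (congrFun hX i) j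
    rw [hQ, ← Matrix.diagonal_one, Matrix.diagonal_sub, Matrix.diagonal_mul, Matrix.zero_apply]
      at this
    exact (mul_eq_zero.1 this).resolve_left (hne i hi)
  have hD1 (X : Matrix n n ℂ) (hX : (1 - Q) * X = 0) :
      Matrix.diagonal E' * X = Matrix.diagonal E * X := by
    ext i j
    rw [Matrix.diagonal_mul, Matrix.diagonal_mul, hE']
    by_cases hi : ‖E i‖ = 1
    · simp [hi]
    · rw [hrow X hX i j hi, mul_zero, mul_zero]
  have hD2 (X : Matrix n n ℂ) (hX : (1 - Q) * X = 0) :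
      (Matrix.diagonal E')ᴴ * X = (Matrix.diagonal E)ᴴ * X := by
    ext i j
    rw [Matrix.diagonal_conjTranspose, Matrix.diagonal_conjTranspose, Matrix.diagonal_mul,
      Matrix.diagonal_mul, hE', Pi.star_apply, Pi.star_apply]
    by_cases hi : ‖E i‖ = 1
    · simp [hi]
    · rw [hrow X hX i j hi, mul_zero, mul_zero]
  refine ⟨E', fun i => ?_, ?_, fun i => ?_⟩
  · by_cases hi : ‖E i‖ = 1 <;> simp [hE', hi]
  · have h1 : U * Matrix.diagonal E' * ρ = V * ρ := by
      rw [mul_assoc, hD1 ρ hz1, ← mul_assoc, hV]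
    have h2 : (U * Matrix.diagonal E')ᴴ * ρ = Vᴴ * ρ := by

      have h4 (F : n → ℂ) : (U * Matrix.diagonal F)ᴴ * ρ =
          (Matrix.diagonal F)ᴴ * (Uᴴ * ρ * U) * Uᴴ := by
        rw [Matrix.conjTranspose_mul]
        simp only [mul_assoc, hU1, mul_one]
      rw [hV, h4, h4, hD2 _ hz2]
    rw [h1, h2, e1]
  · by_cases hi : ‖E i‖ = 1
    · simp only [hE', hi, if_true, hc]
    · have h1 := hcE i
      have h2 : (ρ * U) i i = 0 := by
        have h3 : (1 - ((‖E i‖ ^ 2 : ℝ) : ℂ)) * ‖(ρ * U) i i‖ = 0 := by rw [sub_mul, h1]; ring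
        have h4 := (mul_eq_zero.1 h3).resolve_left (hne i hi)
        exact norm_eq_zero.1 (Complex.ofReal_eq_zero.1 h4)
      rw [h2, zero_mul, norm_zero, Complex.ofReal_zero]

end saddlePoint

/-! ### Balanced minimizers -/

section saddlePoint

variable {n : Type*} [Fintype n] [DecidableEq n]

/-- Pinching a density matrix supported on the eigenspace `V + Vᴴ = 2 * m` of a unitary `V`
to the two eigenspaces of `V` contained in it. -/
theorem exists_isDensity_commute {V ρ : Matrix n n ℂ} {m : ℝ} (hV : V ∈ Matrix.unitaryGroup n ℂ)
    (hm0 : 0 ≤ m) (hm1 : m ≤ 1) (hρ : IsDensity ρ) (h : V * ρ + Vᴴ * ρ = ((2 * m : ℝ) : ℂ) • ρ)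
    (hre : ∀ i, ((ρ * V) i i).im = 0) :
    ∃ ρ', IsDensity ρ' ∧ V * ρ' = ρ' * V ∧ ∀ i, (ρ' * V) i i = m * ρ' i i := by
  have hV1 : V * Vᴴ = 1 := Matrix.mem_unitaryGroup_iff.1 hV
  have hV2 : Vᴴ * V = 1 := Matrix.mem_unitaryGroup_iff'.1 hV
  have hρH : ρᴴ = ρ := hρ.1.1
  obtain ⟨N, hN⟩ : ∃ N, N = V - (m : ℂ) • 1 := ⟨_, rfl⟩
  have hNH : Nᴴ = Vᴴ - (m : ℂ) • 1 := by
    rw [hN, Matrix.conjTranspose_sub, Matrix.conjTranspose_smul, Matrix.conjTranspose_one,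
      Complex.star_def, Complex.conj_ofReal]
  have hVN : V = N + (m : ℂ) • 1 := by rw [hN, sub_add_cancel]
  have e1 : Nᴴ * ρ = -(N * ρ) := by
    rw [← add_eq_zero_iff_eq_neg, hNH, hN]
    simp only [Matrix.sub_mul, Matrix.smul_mul, one_mul]
    have : Vᴴ * ρ - (m : ℂ) • ρ + (V * ρ - (m : ℂ) • ρ) =
        V * ρ + Vᴴ * ρ - ((2 * m : ℝ) : ℂ) • ρ := by push_cast; module
    rw [this, h, sub_self]
  have e2 : ρ * N = -(ρ * Nᴴ) := by
    have := congrArg Matrix.conjTranspose e1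
    rwa [Matrix.conjTranspose_mul, Matrix.conjTranspose_neg, Matrix.conjTranspose_mul, hρH,
      Matrix.conjTranspose_conjTranspose] at this
  have e3 : Nᴴ * N * ρ = ((1 - m ^ 2 : ℝ) : ℂ) • ρ := by
    have h1 : Nᴴ * N = ((1 + m ^ 2 : ℝ) : ℂ) • 1 - (m : ℂ) • (V + Vᴴ) := by
      rw [hNH, hN]
      simp only [Matrix.sub_mul, Matrix.mul_sub, Matrix.smul_mul, Matrix.mul_smul, one_mul,
        mul_one, hV2]
      push_cast
      module
    rw [h1, Matrix.sub_mul, Matrix.smul_mul, Matrix.smul_mul, one_mul, Matrix.add_mul, h]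
    push_cast
    module
  have e3' : ρ * (Nᴴ * N) = ((1 - m ^ 2 : ℝ) : ℂ) • ρ := by
    have := congrArg Matrix.conjTranspose e3
    rwa [Matrix.conjTranspose_mul, Matrix.conjTranspose_mul, Matrix.conjTranspose_smul, hρH,
      Matrix.conjTranspose_conjTranspose, Complex.star_def, Complex.conj_ofReal] at this
  have hnormal : N * Nᴴ = Nᴴ * N := by
    rw [hNH, hN]
    simp only [Matrix.sub_mul, Matrix.mul_sub, Matrix.smul_mul, Matrix.mul_smul, one_mul,
      mul_one, hV1, hV2]
    module
  have e4 : N * (N * ρ) = -(((1 - m ^ 2 : ℝ) : ℂ) • ρ) := by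
    rw [← e3, ← hnormal, mul_assoc, e1, Matrix.mul_neg, neg_neg]
  have e5 : ρ * N * N = -(((1 - m ^ 2 : ℝ) : ℂ) • ρ) := by
    rw [e2, Matrix.neg_mul, mul_assoc, e3']
  -- The sum equals `ρ * N - (ρ * N)ᴴ`, whose diagonal sees only the imaginary parts of `ρ * V`.
  have hdiag (i : n) : (N * ρ + ρ * N) i i = 0 := by
    have h1 : N * ρ = -(ρ * N)ᴴ := by
      rw [Matrix.conjTranspose_mul, hρH, e1, neg_neg]
    have h2 : ((ρ * N) i i).im = 0 := by
      have h3 : (ρ i i).im = 0 := (Complex.nonneg_iff.1 hρ.1.diag_nonneg).2.symm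
      rw [hN, Matrix.mul_sub, Matrix.mul_smul, mul_one, Matrix.sub_apply, Matrix.smul_apply,
        Complex.sub_im, hre, smul_eq_mul, Complex.im_ofReal_mul, h3, mul_zero, sub_zero]
    rw [h1, Matrix.add_apply, Matrix.neg_apply, Matrix.conjTranspose_apply, Complex.star_def,
      Complex.conj_eq_iff_im.2 h2, neg_add_cancel]
  have finish (ρ' : Matrix n n ℂ) (h1 : N * ρ' = (1 / 2 : ℂ) • (N * ρ + ρ * N))
      (h2 : ρ' * N = (1 / 2 : ℂ) • (N * ρ + ρ * N)) :
      V * ρ' = ρ' * V ∧ ∀ i, (ρ' * V) i i = m * ρ' i i := by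
    refine ⟨?_, fun i => ?_⟩
    · rw [hVN, Matrix.add_mul, Matrix.mul_add, h1, h2, Matrix.mul_smul, Matrix.smul_mul, one_mul,
        mul_one]
    · rw [hVN, Matrix.mul_add, h2, Matrix.mul_smul, mul_one, Matrix.add_apply, Matrix.smul_apply,
        hdiag, smul_zero, zero_add, Matrix.smul_apply, smul_eq_mul]
  -- At `m = 1` the two eigenvalues `m ± i √(1 - m²)` merge, and `N` kills `ρ`.
  obtain hm | hm := hm1.eq_or_lt
  · have h1 : N * ρ = 0 := by
      rw [← Matrix.conjTranspose_mul_self_mul_eq_zero, e3, hm]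
      simp
    have h2 : ρ * N = 0 := by
      have := congrArg Matrix.conjTranspose h1
      rw [Matrix.conjTranspose_mul, hρH, Matrix.conjTranspose_zero] at this
      rw [e2, this, neg_zero]
    exact ⟨ρ, hρ, finish ρ (by simp [h1, h2]) (by simp [h1, h2])⟩
  have hs : 0 < 1 - m ^ 2 := by nlinarith
  have hs' : ((1 - m ^ 2 : ℝ) : ℂ) ≠ 0 := by exact_mod_cast hs.ne'
  set s : ℂ := ((1 - m ^ 2 : ℝ) : ℂ) with hsdef
  have hs0 : 0 ≤ s⁻¹ := inv_nonneg.2 (by rw [hsdef, Complex.zero_le_real]; exact hs.le)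
  have half : (0 : ℂ) ≤ 1 / 2 := by
    have : (1 / 2 : ℂ) = ((1 / 2 : ℝ) : ℂ) := by push_cast; rfl
    rw [this, Complex.zero_le_real]
    norm_num
  have hform : N * ρ * Nᴴ = -(N * ρ * N) := by
    rw [mul_assoc, mul_assoc, e2, Matrix.mul_neg, neg_neg]
  -- On the eigenspace `V + Vᴴ = 2m`, `N` is `i √s` times the reflection that separates the two
  -- eigenspaces of `V`. Averaging `ρ` with its conjugate under this reflection is the pinching.
  refine ⟨(1 / 2 : ℂ) • (ρ + s⁻¹ • (N * ρ * Nᴴ)), ⟨?_, ?_⟩, finish _ ?_ ?_⟩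
  · exact (hρ.1.add ((hρ.1.mul_mul_conjTranspose_same N).smul hs0)).smul half
  · rw [Matrix.trace_smul, Matrix.trace_add, Matrix.trace_smul, Matrix.trace_mul_comm,
      ← mul_assoc, e3, Matrix.trace_smul, hρ.2, smul_smul, inv_mul_cancel₀ hs']
    norm_num
  · have : N * (N * ρ * N) = -(s • (ρ * N)) := by
      rw [← mul_assoc, e4, Matrix.neg_mul, Matrix.smul_mul]
    rw [hform, Matrix.mul_smul, Matrix.mul_add, Matrix.mul_smul, Matrix.mul_neg, this, neg_neg,
      smul_smul, inv_mul_cancel₀ hs', one_smul]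
  · have : N * ρ * N * N = -(s • (N * ρ)) := by
      rw [mul_assoc N, mul_assoc N, e5, Matrix.mul_neg, Matrix.mul_smul]
    rw [hform, Matrix.smul_mul, Matrix.add_mul, Matrix.smul_mul, Matrix.neg_mul, this, neg_neg,
      smul_smul, inv_mul_cancel₀ hs', one_smul, add_comm (N * ρ)]

/-- A minimizer of `∑ i, ‖(ρ * U) i i‖` with balanced diagonal entries. -/
theorem exists_balanced_minimizer [Nonempty n] {U : Matrix n n ℂ}
    (hU : U ∈ Matrix.unitaryGroup n ℂ) :
    ∃ (ρ : Matrix n n ℂ) (m : ℝ), IsDensity ρ ∧ 0 ≤ m ∧ m ≤ 1 ∧ ∑ i, ‖(ρ * U) i i‖ = m ∧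
      (∀ σ : Matrix n n ℂ, IsDensity σ → m ≤ ∑ i, ‖(σ * U) i i‖) ∧
      ∀ i, ‖(ρ * U) i i‖ = m * (((ρ i i).re + ((Uᴴ * ρ * U) i i).re) / 2) ∧
        ((ρ i i).re = ((Uᴴ * ρ * U) i i).re ∨ (ρ * U) i i = 0) := by
  obtain ⟨ρ, hρ, hmin⟩ := exists_isMinOn_sum_norm U
  set m := ∑ i, ‖(ρ * U) i i‖ with hm
  have hm1 : m ≤ 1 := sum_norm_mul_unitary_le hU hρ
  have hm0 : 0 ≤ m := Finset.sum_nonneg fun _ _ => norm_nonneg _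
  -- For `m = 0` every overlap vanishes, so any minimizer is balanced; the dual witness needs `m >
  -- 0`.
  obtain h0 | h0 := hm0.eq_or_lt
  · have hz (i : n) : ‖(ρ * U) i i‖ = 0 :=
      (Finset.sum_eq_zero_iff_of_nonneg fun i _ => norm_nonneg ((ρ * U) i i)).1 h0.symm i
        (Finset.mem_univ i)
    exact ⟨ρ, m, hρ, hm0, hm1, hm.symm, hmin, fun i =>
      ⟨by rw [hz, ← h0, zero_mul], .inr (norm_eq_zero.1 (hz i))⟩⟩
  obtain ⟨E, hE, hV, hc⟩ := exists_unitary_eigenvalue_eq hU h0 hmin hρ rfl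
  have hD : Matrix.diagonal E ∈ Matrix.unitaryGroup n ℂ := by
    rw [Matrix.mem_unitaryGroup_iff, Matrix.star_eq_conjTranspose, Matrix.diagonal_conjTranspose,
      Matrix.diagonal_mul_diagonal, ← Matrix.diagonal_one]
    congr 1
    ext i
    simp [Complex.mul_conj', hE i]
  have hVU := mul_mem hU hD
  obtain ⟨σ, hσ, hcomm, hdiag⟩ := exists_isDensity_commute hVU hm0 hm1 hρ hV fun i => by
    rw [← mul_assoc, Matrix.mul_diagonal, hc, Complex.ofReal_im]
  have h1 (i : n) : ‖(σ * U) i i‖ = m * (σ i i).re := by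
    have h2 := congrArg norm (hdiag i)
    have h3 := hσ.1.diag_nonneg (i := i)
    rwa [← mul_assoc, Matrix.mul_diagonal, norm_mul, hE, mul_one, norm_mul, Complex.norm_real,
      Real.norm_of_nonneg hm0, ← Complex.re_eq_norm.2 h3] at h2
  -- Conjugation by `U * diagonal E` fixes `σ`, and the phases `E` cancel on the diagonal.
  have h2 (i : n) : (Uᴴ * σ * U) i i = σ i i := by
    have h3 : (U * Matrix.diagonal E)ᴴ * (σ * (U * Matrix.diagonal E)) = σ := by
      rw [← hcomm, ← mul_assoc, ← Matrix.star_eq_conjTranspose,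
        Matrix.mem_unitaryGroup_iff'.1 hVU, one_mul]
    have h4 := congrFun (congrFun h3 i) i
    have h5 : (U * Matrix.diagonal E)ᴴ * (σ * (U * Matrix.diagonal E)) =
        Matrix.diagonal (star E) * (Uᴴ * σ * U * Matrix.diagonal E) := by
      rw [Matrix.conjTranspose_mul, Matrix.diagonal_conjTranspose]
      simp only [mul_assoc]
    rw [h5, Matrix.diagonal_mul, Matrix.mul_diagonal] at h4
    rw [← h4, mul_left_comm, Pi.star_apply, Complex.star_def, Complex.conj_mul', hE]
    simp
  refine ⟨σ, m, hσ, hm0, hm1, ?_, hmin, fun i => ⟨?_, .inl (by rw [h2])⟩⟩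
  · have h3 : ∑ i, (σ i i).re = 1 := by
      have := congrArg Complex.re hσ.2
      rwa [Matrix.trace, Complex.re_sum, Complex.one_re] at this
    simp only [h1, ← Finset.mul_sum, h3, mul_one]
  · rw [h1, h2]; ring

/-- The change of basis `ρ ↦ U₁ * ρ * U₁ᴴ` reduces the pair to the single unitary `U₁ᴴ * U₂`. -/
theorem exists_balanced_minimizer_pair [Nonempty n] {U₁ U₂ : Matrix n n ℂ}
    (hU₁ : U₁ ∈ Matrix.unitaryGroup n ℂ) (hU₂ : U₂ ∈ Matrix.unitaryGroup n ℂ) :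
    ∃ (ρ : Matrix n n ℂ) (m : ℝ), IsDensity ρ ∧ 0 ≤ m ∧ m ≤ 1 ∧ ∑ i, ‖(U₁ᴴ * ρ * U₂) i i‖ = m ∧
      (∀ σ : Matrix n n ℂ, IsDensity σ → m ≤ ∑ i, ‖(U₁ᴴ * σ * U₂) i i‖) ∧
      ∀ i, ‖(U₁ᴴ * ρ * U₂) i i‖ =
          m * ((((U₁ᴴ * ρ * U₁) i i).re + ((U₂ᴴ * ρ * U₂) i i).re) / 2) ∧
        (((U₁ᴴ * ρ * U₁) i i).re = ((U₂ᴴ * ρ * U₂) i i).re ∨ (U₁ᴴ * ρ * U₂) i i = 0) := by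
  have h1 : U₁ * U₁ᴴ = 1 := Matrix.mem_unitaryGroup_iff.1 hU₁
  have h2 : U₁ᴴ * U₁ = 1 := Matrix.mem_unitaryGroup_iff'.1 hU₁
  have hU : U₁ᴴ * U₂ ∈ Matrix.unitaryGroup n ℂ := mul_mem (Unitary.star_mem hU₁) hU₂
  obtain ⟨ρ, m, hρ, hm0, hm1, hm, hmin, hbal⟩ := exists_balanced_minimizer hU
  have e1 : U₁ᴴ * (U₁ * ρ * U₁ᴴ) * U₂ = ρ * (U₁ᴴ * U₂) := by
    simp only [mul_assoc]
    rw [← mul_assoc U₁ᴴ U₁, h2, one_mul]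
  have e2 : U₁ᴴ * (U₁ * ρ * U₁ᴴ) * U₁ = ρ := by
    simp only [mul_assoc, h2, mul_one]
    rw [← mul_assoc U₁ᴴ U₁, h2, one_mul]
  have e3 : U₂ᴴ * (U₁ * ρ * U₁ᴴ) * U₂ = (U₁ᴴ * U₂)ᴴ * ρ * (U₁ᴴ * U₂) := by
    rw [Matrix.conjTranspose_mul, Matrix.conjTranspose_conjTranspose]
    simp only [mul_assoc]
  refine ⟨U₁ * ρ * U₁ᴴ, m, ⟨hρ.1.mul_mul_conjTranspose_same _, ?_⟩, hm0, hm1, ?_, fun σ hσ => ?_, ?_⟩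
  · rw [Matrix.trace_mul_comm, ← mul_assoc, h2, one_mul, hρ.2]
  · rw [e1, hm]
  · have := hmin (U₁ᴴ * σ * U₁) ⟨hσ.1.conjTranspose_mul_mul_same _, by
      rw [Matrix.trace_mul_comm, ← mul_assoc, h1, one_mul, hσ.2]⟩
    have e4 : U₁ᴴ * σ * U₁ * (U₁ᴴ * U₂) = U₁ᴴ * σ * U₂ := by
      simp only [mul_assoc]
      rw [← mul_assoc U₁ U₁ᴴ, h1, one_mul]
    rwa [e4] at this
  · rw [e1, e2, e3]
    exact hbal

end saddlePoint

/-! ### Block diagonal operators indexed by the label -/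

section blocks

variable {d k : ℕ}

/-- The vector `|i⟩ ⊗ |x⟩`. -/
def labelVec (i : Fin d) (x : Fin k → ℂ) : Fin d × Fin k → ℂ :=
  fun p => if p.1 = i then x p.2 else 0

/-- The diagonal block `(⟨i| ⊗ 1) M (|i⟩ ⊗ 1)`. -/
def diagBlock (M : Matrix (Fin d × Fin k) (Fin d × Fin k) ℂ) (i : Fin d) :
    Matrix (Fin k) (Fin k) ℂ :=
  M.submatrix (Prod.mk i) (Prod.mk i)

/-- The block diagonal matrix `∑ i, |i⟩⟨i| ⊗ W i`. -/
noncomputable def labelSum (W : Fin d → Matrix (Fin k) (Fin k) ℂ) :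
    Matrix (Fin d × Fin k) (Fin d × Fin k) ℂ :=
  ∑ i, Matrix.single i i (1 : ℂ) ⊗ₖ W i

theorem labelSum_apply (W : Fin d → Matrix (Fin k) (Fin k) ℂ) (p q : Fin d × Fin k) :
    labelSum W p q = if p.1 = q.1 then W p.1 p.2 q.2 else 0 := by
  rw [labelSum, Matrix.sum_apply]
  simp only [Matrix.kroneckerMap_apply, Matrix.single_apply]
  rw [Finset.sum_eq_single p.1 (fun i _ hi => by simp [hi]) (by simp)]
  by_cases h : p.1 = q.1 <;> simp [h]

theorem diagBlock_labelSum (W : Fin d → Matrix (Fin k) (Fin k) ℂ) (i : Fin d) :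
    diagBlock (labelSum W) i = W i := by
  ext j j'
  simp [diagBlock, labelSum_apply]

theorem single_kronecker_vecMulVec (i : Fin d) (x y : Fin k → ℂ) :
    Matrix.single i i (1 : ℂ) ⊗ₖ Matrix.vecMulVec x (star y) =
      Matrix.vecMulVec (labelVec i x) (star (labelVec i y)) := by
  ext p q
  simp only [Matrix.kroneckerMap_apply, Matrix.single_apply, Matrix.vecMulVec_apply, labelVec,
    Pi.star_apply]
  by_cases h1 : p.1 = i <;> by_cases h2 : q.1 = i <;> simp [h1, h2, eq_comm (a := i)]

theorem star_labelVec_dotProduct (i : Fin d) (x : Fin k → ℂ) (y : Fin d × Fin k → ℂ) :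
    star (labelVec i x) ⬝ᵥ y = star x ⬝ᵥ fun j => y (i, j) := by
  simp only [dotProduct, Fintype.sum_prod_type, Pi.star_apply, labelVec]
  rw [Finset.sum_eq_single i (fun i' _ hi => by simp [hi]) (by simp)]
  simp

theorem normSq_labelVec (i : Fin d) (x : Fin k → ℂ) : normSq (labelVec i x) = normSq x := by
  rw [normSq_eq_re, normSq_eq_re, star_labelVec_dotProduct]
  simp [labelVec]

theorem star_labelVec_dotProduct_mulVec (M : Matrix (Fin d × Fin k) (Fin d × Fin k) ℂ)
    (i : Fin d) (x y : Fin k → ℂ) :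
    star (labelVec i x) ⬝ᵥ (M *ᵥ labelVec i y) = star x ⬝ᵥ (diagBlock M i *ᵥ y) := by
  rw [star_labelVec_dotProduct]
  congr 1
  ext j
  simp only [Matrix.mulVec, dotProduct, Fintype.sum_prod_type, labelVec, diagBlock,
    Matrix.submatrix_apply]
  rw [Finset.sum_eq_single i (fun i' _ hi => by simp [hi]) (by simp)]
  simp

theorem star_dotProduct_labelSum_mulVec (W : Fin d → Matrix (Fin k) (Fin k) ℂ)
    (x y : Fin d × Fin k → ℂ) :
    star x ⬝ᵥ (labelSum W *ᵥ y) =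
      ∑ i, star (fun j => x (i, j)) ⬝ᵥ (W i *ᵥ fun j => y (i, j)) := by
  simp only [Matrix.mulVec, dotProduct, Fintype.sum_prod_type, labelSum_apply, ite_mul, zero_mul]
  refine Finset.sum_congr rfl fun i _ => Finset.sum_congr rfl fun j _ => ?_
  congr 1
  rw [Finset.sum_eq_single i (fun i' _ hi => by simp [hi.symm]) (by simp)]
  simp

theorem IsContraction.diagBlock {W : Matrix (Fin d × Fin k) (Fin d × Fin k) ℂ}
    (hW : IsContraction W) (i : Fin d) : IsContraction (diagBlock W i) := by
  intro x y
  rw [← star_labelVec_dotProduct_mulVec, ← normSq_labelVec i x, ← normSq_labelVec i y]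
  exact hW _ _

theorem isContraction_labelSum {W : Fin d → Matrix (Fin k) (Fin k) ℂ}
    (hW : ∀ i, IsContraction (W i)) : IsContraction (labelSum W) := by
  intro x y
  have h (x : Fin d × Fin k → ℂ) : normSq x = ∑ i, normSq fun j => x (i, j) := by
    simp only [normSq, Fintype.sum_prod_type]
  rw [star_dotProduct_labelSum_mulVec, h x, h y]
  exact (norm_sum_le _ _).trans ((Finset.sum_le_sum fun i _ => hW i _ _).trans
    (Real.sum_sqrt_mul_sqrt_le _ (fun _ => normSq_nonneg _) fun _ => normSq_nonneg _))

theorem labelSum_posSemidef {W : Fin d → Matrix (Fin k) (Fin k) ℂ}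
    (hW : ∀ i, (W i).PosSemidef) : (labelSum W).PosSemidef := by
  refine .of_dotProduct_mulVec_nonneg ?_ fun x => ?_
  · ext p q
    rw [Matrix.conjTranspose_apply, labelSum_apply, labelSum_apply]
    by_cases h : p.1 = q.1
    · rw [if_pos h, if_pos h.symm, h, ← Matrix.conjTranspose_apply, (hW q.1).1.eq]
    · rw [if_neg h, if_neg (Ne.symm h), star_zero]
  · rw [star_dotProduct_labelSum_mulVec]
    exact Finset.sum_nonneg fun i _ => (hW i).dotProduct_mulVec_nonneg _

theorem labelMeasurement_isPOVM {T : Fin d → Fin 3 → Matrix (Fin k) (Fin k) ℂ}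
    (hT : ∀ i, IsPOVM (T i)) : IsPOVM (labelMeasurement T) := by
  refine ⟨fun a => labelSum_posSemidef fun i => (hT i).1 a, ?_⟩
  ext p q
  have h (a : Fin 3) : labelMeasurement T a p q = if p.1 = q.1 then T p.1 a p.2 q.2 else 0 :=
    labelSum_apply (fun i => T i a) p q
  rw [Matrix.sum_apply]
  simp only [h]
  by_cases hpq : p.1 = q.1
  · simp only [hpq, if_true]
    rw [← Matrix.sum_apply, (hT q.1).2, Matrix.one_apply, Matrix.one_apply]
    simp [Prod.ext_iff, hpq]
  · simp only [hpq, if_false, Finset.sum_const_zero]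
    rw [Matrix.one_apply_ne (fun h => hpq (congrArg Prod.fst h))]

theorem IsPOVM.diagBlock {o : Type*} [Fintype o]
    {M : o → Matrix (Fin d × Fin k) (Fin d × Fin k) ℂ} (hM : IsPOVM M) (i : Fin d) :
    IsPOVM fun a => diagBlock (M a) i := by
  refine ⟨fun a => (hM.1 a).submatrix _, ?_⟩
  ext j j'
  have := congrFun (congrFun hM.2 (i, j)) (i, j')
  rw [Matrix.sum_apply] at this ⊢
  simp only [_root_.diagBlock, Matrix.submatrix_apply]
  rw [this, Matrix.one_apply, Matrix.one_apply]
  simp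

end blocks

/-! ### Measurement outputs and the reduced input state -/

section channels

variable {d k : ℕ}

theorem ampliate_sum {n m ι : Type*} (S : Matrix n n ℂ →ₗ[ℂ] Matrix m m ℂ) (s : Finset ι)
    (X : ι → Matrix (n × Fin k) (n × Fin k) ℂ) :
    ampliate S k (∑ j ∈ s, X j) = ∑ j ∈ s, ampliate S k (X j) := by
  ext p q
  rw [Matrix.sum_apply]
  have h : (Matrix.of fun i i' => (∑ j ∈ s, X j) (i, p.2) (i', q.2)) =
      ∑ j ∈ s, Matrix.of fun i i' => X j (i, p.2) (i', q.2) := by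
    ext i i'
    simp [Matrix.sum_apply]
  simp only [ampliate, Matrix.of_apply]
  rw [h, map_sum, Matrix.sum_apply]

theorem ampliate_sub {n m : Type*} (S₁ S₂ : Matrix n n ℂ →ₗ[ℂ] Matrix m m ℂ)
    (X : Matrix (n × Fin k) (n × Fin k) ℂ) :
    ampliate (S₁ - S₂) k X = ampliate S₁ k X - ampliate S₂ k X := by
  ext p q
  simp [ampliate]

theorem ampliate_vnChannel_vecMulVec (U : Matrix (Fin d) (Fin d) ℂ) (u v : Fin d × Fin k → ℂ) :
    ampliate (vnChannel U) k (Matrix.vecMulVec u (star v)) =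
      ∑ i, Matrix.vecMulVec (labelVec i (ancillaVec U u i))
        (star (labelVec i (ancillaVec U v i))) := by
  ext p q
  have h1 (i : Fin d) : (vonNeumann U i * Matrix.of fun a a' =>
      Matrix.vecMulVec u (star v) (a, p.2) (a', q.2)).trace =
      ancillaVec U u i p.2 * star (ancillaVec U v i q.2) := by
    have : (Matrix.of fun a a' => Matrix.vecMulVec u (star v) (a, p.2) (a', q.2)) =
        Matrix.vecMulVec (fun a => u (a, p.2)) (star fun a => v (a, q.2)) := rfl
    rw [this, vonNeumann, ketbra, Matrix.vecMulVec_mul_vecMulVec, Matrix.trace_vecMulVec,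
      dotProduct_smul, smul_eq_mul]
    congr 1
    simp [ancillaVec, dotProduct]
  simp only [ampliate, Matrix.of_apply, vnChannel, measChannel, LinearMap.coe_mk, AddHom.coe_mk]
  rw [Matrix.sum_apply, Matrix.sum_apply]
  refine Finset.sum_congr rfl fun i _ => ?_
  rw [h1, Matrix.smul_apply, Matrix.single_apply, Matrix.vecMulVec_apply, Pi.star_apply, labelVec,
    labelVec]
  by_cases h2 : p.1 = i <;> by_cases h3 : q.1 = i <;> simp [h2, h3, eq_comm (a := i)]

theorem ampliate_vnChannel_ketbra (U : Matrix (Fin d) (Fin d) ℂ) (ψ : Fin d × Fin k → ℂ) :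
    ampliate (vnChannel U) k (ketbra ψ) =
      ∑ i, Matrix.single i i (1 : ℂ) ⊗ₖ ketbra (ancillaVec U ψ i) := by
  rw [ketbra, ampliate_vnChannel_vecMulVec]
  exact Finset.sum_congr rfl fun i _ => (single_kronecker_vecMulVec _ _ _).symm

theorem trace_mul_ampliate_vecMulVec (M : Matrix (Fin d × Fin k) (Fin d × Fin k) ℂ)
    (U : Matrix (Fin d) (Fin d) ℂ) (u v : Fin d × Fin k → ℂ) :
    (M * ampliate (vnChannel U) k (Matrix.vecMulVec u (star v))).trace =
      ∑ i, star (ancillaVec U v i) ⬝ᵥ (diagBlock M i *ᵥ ancillaVec U u i) := by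
  rw [ampliate_vnChannel_vecMulVec, Finset.mul_sum, Matrix.trace_sum]
  refine Finset.sum_congr rfl fun i _ => ?_
  rw [trace_mul_vecMulVec_star, star_labelVec_dotProduct_mulVec]

theorem trace_mul_ampliate_ketbra (M : Matrix (Fin d × Fin k) (Fin d × Fin k) ℂ)
    (U : Matrix (Fin d) (Fin d) ℂ) (ψ : Fin d × Fin k → ℂ) :
    (M * ampliate (vnChannel U) k (ketbra ψ)).trace =
      ∑ i, (diagBlock M i * ketbra (ancillaVec U ψ i)).trace := by
  rw [ketbra, trace_mul_ampliate_vecMulVec]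
  exact Finset.sum_congr rfl fun i _ => (trace_mul_ketbra _ _).symm

/-- The partial trace of `|ψ⟩⟨ψ|` over the ancilla. -/
noncomputable def reducedState (ψ : Fin d × Fin k → ℂ) : Matrix (Fin d) (Fin d) ℂ :=
  Matrix.of (fun a j => ψ (a, j)) * (Matrix.of fun a j => ψ (a, j))ᴴ

theorem reducedState_posSemidef (ψ : Fin d × Fin k → ℂ) : (reducedState ψ).PosSemidef :=
  Matrix.posSemidef_self_mul_conjTranspose _

/-- All inner products of the ancilla vectors with one label depend on the input only through its
reduced state; this makes the problem a minimization over `ρ`. -/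
theorem star_ancillaVec_dotProduct (U₁ U₂ : Matrix (Fin d) (Fin d) ℂ) (ψ : Fin d × Fin k → ℂ)
    (i : Fin d) : star (ancillaVec U₂ ψ i) ⬝ᵥ ancillaVec U₁ ψ i =
      (U₁ᴴ * reducedState ψ * U₂) i i := by
  have h (U : Matrix (Fin d) (Fin d) ℂ) (j : Fin k) :
      ancillaVec U ψ i j = (Uᴴ * Matrix.of fun a j => ψ (a, j)) i j := rfl
  have h2 : U₁ᴴ * reducedState ψ * U₂ = (U₁ᴴ * Matrix.of fun a j => ψ (a, j)) *
      (U₂ᴴ * Matrix.of fun a j => ψ (a, j))ᴴ := by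
    rw [reducedState, Matrix.conjTranspose_mul, Matrix.conjTranspose_conjTranspose]
    simp only [Matrix.mul_assoc]
  rw [h2, Matrix.mul_apply, dotProduct]
  refine Finset.sum_congr rfl fun j _ => ?_
  rw [Pi.star_apply, h, h, Matrix.conjTranspose_apply, mul_comm]

theorem normSq_ancillaVec (U : Matrix (Fin d) (Fin d) ℂ) (ψ : Fin d × Fin k → ℂ) (i : Fin d) :
    normSq (ancillaVec U ψ i) = ((Uᴴ * reducedState ψ * U) i i).re := by
  rw [normSq_eq_re, star_ancillaVec_dotProduct]

theorem norm_star_ancillaVec_dotProduct (U₁ U₂ : Matrix (Fin d) (Fin d) ℂ)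
    (ψ : Fin d × Fin k → ℂ) (i : Fin d) :
    ‖star (ancillaVec U₁ ψ i) ⬝ᵥ ancillaVec U₂ ψ i‖ = ‖(U₁ᴴ * reducedState ψ * U₂) i i‖ := by
  rw [star_dotProduct_comm, norm_star, star_ancillaVec_dotProduct]

theorem re_trace_reducedState (ψ : Fin d × Fin k → ℂ) :
    (reducedState ψ).trace.re = normSq ψ := by
  simp [reducedState, Matrix.trace, Matrix.mul_apply, normSq, Fintype.sum_prod_type,
    Complex.mul_conj', ← Complex.ofReal_pow]

theorem sum_normSq_ancillaVec {U : Matrix (Fin d) (Fin d) ℂ}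
    (hU : U ∈ Matrix.unitaryGroup (Fin d) ℂ) (ψ : Fin d × Fin k → ℂ) :
    ∑ i, normSq (ancillaVec U ψ i) = normSq ψ := by
  simp only [normSq_ancillaVec]
  rw [← re_trace_reducedState, ← Complex.re_sum]
  change (Uᴴ * reducedState ψ * U).trace.re = _
  rw [Matrix.trace_mul_comm, ← mul_assoc, ← Matrix.star_eq_conjTranspose,
    Matrix.mem_unitaryGroup_iff.1 hU, one_mul]

/-- Purification: a factor `C` with `ρ = C * Cᴴ`, read as a vector. Since `C` is square, an ancilla
of dimension `d` suffices. -/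
theorem exists_reducedState_eq {ρ : Matrix (Fin d) (Fin d) ℂ} (hρ : IsDensity ρ) :
    ∃ ψ : Fin d × Fin d → ℂ, star ψ ⬝ᵥ ψ = 1 ∧ reducedState ψ = ρ := by
  obtain ⟨C, hC⟩ := hρ.1.exists_eq_mul_conjTranspose
  have h : reducedState (fun p : Fin d × Fin d => C p.1 p.2) = ρ := hC.symm
  refine ⟨fun p => C p.1 p.2, ?_, h⟩
  rw [star_dotProduct_self, ← re_trace_reducedState, h, hρ.2]
  simp

end channels

/-! ### Optimal unambiguous discrimination of the measurements -/

section discrimination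

variable {d k : ℕ}

theorem successProb_ampliate_ketbra (U₁ U₂ : Matrix (Fin d) (Fin d) ℂ) (ψ : Fin d × Fin k → ℂ)
    (M : Fin 3 → Matrix (Fin d × Fin k) (Fin d × Fin k) ℂ) :
    successProb (ampliate (vnChannel U₁) k (ketbra ψ)) (ampliate (vnChannel U₂) k (ketbra ψ)) M =
      ∑ i, successProb (ketbra (ancillaVec U₁ ψ i)) (ketbra (ancillaVec U₂ ψ i))
        fun x => diagBlock (M x) i := by
  simp only [successProb, trace_mul_ampliate_ketbra, Complex.re_sum, ← Finset.mul_sum,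
    ← Finset.sum_add_distrib]

theorem IsUnambiguous.diagBlock {U₁ U₂ : Matrix (Fin d) (Fin d) ℂ} {ψ : Fin d × Fin k → ℂ}
    {M : Fin 3 → Matrix (Fin d × Fin k) (Fin d × Fin k) ℂ}
    (hM : IsUnambiguous (ampliate (vnChannel U₁) k (ketbra ψ))
      (ampliate (vnChannel U₂) k (ketbra ψ)) M) (i : Fin d) :
    IsUnambiguous (ketbra (ancillaVec U₁ ψ i)) (ketbra (ancillaVec U₂ ψ i))
      fun x => diagBlock (M x) i := by
  obtain ⟨h1, h2, h3⟩ := hM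
  have nonneg (U : Matrix (Fin d) (Fin d) ℂ) (x : Fin 3) (i : Fin d) :
      0 ≤ (_root_.diagBlock (M x) i * ketbra (ancillaVec U ψ i)).trace :=
    ((h1.diagBlock i).1 x).trace_mul_nonneg (ketbra_posSemidef _)
  rw [trace_mul_ampliate_ketbra, Finset.sum_eq_zero_iff_of_nonneg fun i _ => nonneg _ _ i] at h2 h3
  exact ⟨h1.diagBlock i, h2 i (Finset.mem_univ i), h3 i (Finset.mem_univ i)⟩

theorem diagBlock_labelMeasurement (T : Fin d → Fin 3 → Matrix (Fin k) (Fin k) ℂ) (i : Fin d) :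
    (fun x => diagBlock (labelMeasurement T x) i) = T i :=
  funext fun x => diagBlock_labelSum (fun i => T i x) i

theorem successProb_labelMeasurement (U₁ U₂ : Matrix (Fin d) (Fin d) ℂ) (ψ : Fin d × Fin k → ℂ)
    (T : Fin d → Fin 3 → Matrix (Fin k) (Fin k) ℂ) :
    successProb (ampliate (vnChannel U₁) k (ketbra ψ)) (ampliate (vnChannel U₂) k (ketbra ψ))
      (labelMeasurement T) =
      ∑ i, successProb (ketbra (ancillaVec U₁ ψ i)) (ketbra (ancillaVec U₂ ψ i)) (T i) := by
  simp only [successProb_ampliate_ketbra, diagBlock_labelMeasurement]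

theorem labelMeasurement_isUnambiguous {U₁ U₂ : Matrix (Fin d) (Fin d) ℂ} {ψ : Fin d × Fin k → ℂ}
    {T : Fin d → Fin 3 → Matrix (Fin k) (Fin k) ℂ}
    (hT : ∀ i, IsUnambiguous (ketbra (ancillaVec U₁ ψ i)) (ketbra (ancillaVec U₂ ψ i)) (T i)) :
    IsUnambiguous (ampliate (vnChannel U₁) k (ketbra ψ)) (ampliate (vnChannel U₂) k (ketbra ψ))
      (labelMeasurement T) := by
  have h (i : Fin d) (x : Fin 3) : diagBlock (labelMeasurement T x) i = T i x :=
    congrFun (diagBlock_labelMeasurement T i) x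
  refine ⟨labelMeasurement_isPOVM fun i => (hT i).1, ?_, ?_⟩
  · rw [trace_mul_ampliate_ketbra]
    exact Finset.sum_eq_zero fun i _ => by rw [h, (hT i).2.1]
  · rw [trace_mul_ampliate_ketbra]
    exact Finset.sum_eq_zero fun i _ => by rw [h, (hT i).2.2]

/-- Reading the label and then discriminating the states on the ancilla optimally is optimal. -/
theorem labelMeasurement_isOptimalUnambiguous {U₁ U₂ : Matrix (Fin d) (Fin d) ℂ}
    {ψ : Fin d × Fin k → ℂ} {T : Fin d → Fin 3 → Matrix (Fin k) (Fin k) ℂ}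
    (hT : ∀ i, IsOptimalUnambiguous (ketbra (ancillaVec U₁ ψ i)) (ketbra (ancillaVec U₂ ψ i))
      (T i)) :
    IsOptimalUnambiguous (ampliate (vnChannel U₁) k (ketbra ψ))
      (ampliate (vnChannel U₂) k (ketbra ψ)) (labelMeasurement T) := by
  refine ⟨labelMeasurement_isUnambiguous fun i => (hT i).1, fun M hM => ?_⟩
  rw [successProb_labelMeasurement, successProb_ampliate_ketbra]
  exact Finset.sum_le_sum fun i _ => (hT i).2 _ (hM.diagBlock i)

variable {U₁ U₂ : Matrix (Fin d) (Fin d) ℂ} {m : ℝ}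

theorem successProb_le_of_isUnambiguous_ketbra [Nonempty (Fin d)]
    (hU₁ : U₁ ∈ Matrix.unitaryGroup (Fin d) ℂ) (hU₂ : U₂ ∈ Matrix.unitaryGroup (Fin d) ℂ)
    (hm : ∀ ρ : Matrix (Fin d) (Fin d) ℂ, IsDensity ρ → m ≤ ∑ i, ‖(U₁ᴴ * ρ * U₂) i i‖)
    {ψ : Fin d × Fin k → ℂ} {M : Fin 3 → Matrix (Fin d × Fin k) (Fin d × Fin k) ℂ}
    (hM : IsUnambiguous (ampliate (vnChannel U₁) k (ketbra ψ))
      (ampliate (vnChannel U₂) k (ketbra ψ)) M) :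
    successProb (ampliate (vnChannel U₁) k (ketbra ψ)) (ampliate (vnChannel U₂) k (ketbra ψ)) M ≤
      (1 - m) * normSq ψ := by
  rw [successProb_ampliate_ketbra]
  have h := mul_re_trace_le_sum_norm hm (reducedState_posSemidef ψ)
  rw [re_trace_reducedState] at h
  calc _ ≤ ∑ i, ((normSq (ancillaVec U₁ ψ i) + normSq (ancillaVec U₂ ψ i)) / 2 -
        ‖(U₁ᴴ * reducedState ψ * U₂) i i‖) := Finset.sum_le_sum fun i _ => by
          rw [← norm_star_ancillaVec_dotProduct]
          exact successProb_ketbra_le (hM.diagBlock i)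
    _ ≤ _ := by
        rw [Finset.sum_sub_distrib, ← Finset.sum_div, Finset.sum_add_distrib,
          sum_normSq_ancillaVec hU₁, sum_normSq_ancillaVec hU₂]
        linarith

theorem successProb_le_of_isUnambiguous [Nonempty (Fin d)]
    (hU₁ : U₁ ∈ Matrix.unitaryGroup (Fin d) ℂ) (hU₂ : U₂ ∈ Matrix.unitaryGroup (Fin d) ℂ)
    (hm : ∀ ρ : Matrix (Fin d) (Fin d) ℂ, IsDensity ρ → m ≤ ∑ i, ‖(U₁ᴴ * ρ * U₂) i i‖)
    {σ : Matrix (Fin d × Fin k) (Fin d × Fin k) ℂ} (hσ : IsDensity σ)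
    {M : Fin 3 → Matrix (Fin d × Fin k) (Fin d × Fin k) ℂ}
    (hM : IsUnambiguous (ampliate (vnChannel U₁) k σ) (ampliate (vnChannel U₂) k σ) M) :
    successProb (ampliate (vnChannel U₁) k σ) (ampliate (vnChannel U₂) k σ) M ≤ 1 - m := by
  -- A mixed input is a sum of unnormalized pure ones. The error traces are nonnegative and sum to
  -- zero, so the same measurement is unambiguous for each pure term.
  obtain ⟨C, hC⟩ := hσ.1.exists_eq_mul_conjTranspose
  rw [mul_conjTranspose_eq_sum_ketbra] at hC
  set φ : Fin d × Fin k → Fin d × Fin k → ℂ := fun j i => C i j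
  have htr (x : Fin 3) (U : Matrix (Fin d) (Fin d) ℂ) : (M x * ampliate (vnChannel U) k σ).trace =
      ∑ j, (M x * ampliate (vnChannel U) k (ketbra (φ j))).trace := by
    rw [hC, ampliate_sum, Finset.mul_sum, Matrix.trace_sum]
  obtain ⟨h1, h2, h3⟩ := hM
  have nonneg (U : Matrix (Fin d) (Fin d) ℂ) (x : Fin 3) (j : Fin d × Fin k) :
      0 ≤ (M x * ampliate (vnChannel U) k (ketbra (φ j))).trace := by
    rw [trace_mul_ampliate_ketbra]
    exact Finset.sum_nonneg fun i _ =>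
      ((h1.diagBlock i).1 x).trace_mul_nonneg (ketbra_posSemidef _)
  rw [htr, Finset.sum_eq_zero_iff_of_nonneg fun j _ => nonneg _ _ j] at h2 h3
  have hj (j : Fin d × Fin k) := successProb_le_of_isUnambiguous_ketbra hU₁ hU₂ hm (ψ := φ j)
    (M := M) ⟨h1, h2 j (Finset.mem_univ j), h3 j (Finset.mem_univ j)⟩
  have hsum : ∑ j, normSq (φ j) = 1 := by
    have h4 := congrArg Complex.re hσ.2
    rw [hC, Matrix.trace_sum, Complex.re_sum, Complex.one_re] at h4
    rw [← h4]
    refine Finset.sum_congr rfl fun j _ => ?_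
    rw [ketbra, Matrix.trace_vecMulVec, dotProduct_comm, normSq_eq_re]
  calc successProb (ampliate (vnChannel U₁) k σ) (ampliate (vnChannel U₂) k σ) M =
      ∑ j, successProb (ampliate (vnChannel U₁) k (ketbra (φ j)))
        (ampliate (vnChannel U₂) k (ketbra (φ j))) M := by
        simp only [successProb, htr, Complex.re_sum, ← Finset.mul_sum, ← Finset.sum_add_distrib]
    _ ≤ ∑ j, (1 - m) * normSq (φ j) := Finset.sum_le_sum fun j _ => hj j
    _ = 1 - m := by rw [← Finset.mul_sum, hsum, mul_one]

/-- Lower bound on the success probability of the label scheme for balanced inputs. -/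
theorem le_successProb_labelMeasurement
    (hU₁ : U₁ ∈ Matrix.unitaryGroup (Fin d) ℂ) (hU₂ : U₂ ∈ Matrix.unitaryGroup (Fin d) ℂ)
    {ψ : Fin d × Fin k → ℂ} (hψ : normSq ψ = 1)
    (hm : ∑ i, ‖(U₁ᴴ * reducedState ψ * U₂) i i‖ = m)
    (h : ∀ i, ‖(U₁ᴴ * reducedState ψ * U₂) i i‖ ≤ normSq (ancillaVec U₁ ψ i) ∧
      ‖(U₁ᴴ * reducedState ψ * U₂) i i‖ ≤ normSq (ancillaVec U₂ ψ i))
    {T : Fin d → Fin 3 → Matrix (Fin k) (Fin k) ℂ}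
    (hT : ∀ i, IsOptimalUnambiguous (ketbra (ancillaVec U₁ ψ i)) (ketbra (ancillaVec U₂ ψ i))
      (T i)) :
    1 - m ≤ successProb (ampliate (vnChannel U₁) k (ketbra ψ))
      (ampliate (vnChannel U₂) k (ketbra ψ)) (labelMeasurement T) := by
  rw [successProb_labelMeasurement]
  calc 1 - m = ∑ i, ((normSq (ancillaVec U₁ ψ i) + normSq (ancillaVec U₂ ψ i)) / 2 -
        ‖(U₁ᴴ * reducedState ψ * U₂) i i‖) := by
        rw [Finset.sum_sub_distrib, ← Finset.sum_div, Finset.sum_add_distrib,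
          sum_normSq_ancillaVec hU₁, sum_normSq_ancillaVec hU₂, hm, hψ]
        norm_num
    _ ≤ _ := Finset.sum_le_sum fun i _ => by
        have h1 := h i
        rw [← norm_star_ancillaVec_dotProduct] at h1 ⊢
        obtain ⟨M, hM, hs⟩ := exists_isUnambiguous_ketbra h1.1 h1.2
        rw [← hs]
        exact (hT i).2 M hM

end discrimination

/-! ### The diamond norm of the difference -/

section diamond

variable {d k : ℕ} {U₁ U₂ : Matrix (Fin d) (Fin d) ℂ} {m : ℝ}

theorem re_trace_mul_ampliate_vecMulVec_le [Nonempty (Fin d)] (hm0 : 0 ≤ m)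
    (hU₁ : U₁ ∈ Matrix.unitaryGroup (Fin d) ℂ) (hU₂ : U₂ ∈ Matrix.unitaryGroup (Fin d) ℂ)
    (hm : ∀ ρ : Matrix (Fin d) (Fin d) ℂ, IsDensity ρ → m ≤ ∑ i, ‖(U₁ᴴ * ρ * U₂) i i‖)
    {W : Matrix (Fin d × Fin k) (Fin d × Fin k) ℂ} (hW : IsContraction W)
    (u v : Fin d × Fin k → ℂ) :
    (W * ampliate (vnChannel U₁ - vnChannel U₂) k (Matrix.vecMulVec u (star v))).trace.re ≤
      (normSq u + normSq v) * √(1 - m ^ 2) := by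
  set s := normSq u + normSq v
  have hs0 : 0 ≤ s := add_nonneg (normSq_nonneg u) (normSq_nonneg v)
  set S : Fin d → ℝ := fun i => (normSq (ancillaVec U₁ u i) + normSq (ancillaVec U₂ u i) +
    (normSq (ancillaVec U₁ v i) + normSq (ancillaVec U₂ v i))) / 2 with hS
  set g : Fin d → ℝ := fun i => ‖star (ancillaVec U₁ u i) ⬝ᵥ ancillaVec U₂ u i +
    star (ancillaVec U₁ v i) ⬝ᵥ ancillaVec U₂ v i‖
  have hg0 (i : Fin d) : 0 ≤ g i := norm_nonneg _
  have hgS (i : Fin d) : g i ≤ S i := by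
    have h1 := norm_star_dotProduct_le_half (ancillaVec U₁ u i) (ancillaVec U₂ u i)
    have h2 := norm_star_dotProduct_le_half (ancillaVec U₁ v i) (ancillaVec U₂ v i)
    refine (norm_add_le _ _).trans ?_
    rw [hS]
    linarith
  have hsumS : ∑ i, S i = s := by
    simp only [hS]
    rw [← Finset.sum_div, Finset.sum_add_distrib, Finset.sum_add_distrib, Finset.sum_add_distrib,
      sum_normSq_ancillaVec hU₁, sum_normSq_ancillaVec hU₂, sum_normSq_ancillaVec hU₁,
      sum_normSq_ancillaVec hU₂]
    ring
  have hsumg : m * s ≤ ∑ i, g i := by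
    -- The sum of the two reduced states enters as one unnormalized state, matching the overlaps of
    -- `u` and `v` that stand under a single modulus in `g`.
    have h := mul_re_trace_le_sum_norm hm
      ((reducedState_posSemidef u).add (reducedState_posSemidef v))
    rw [Matrix.trace_add, Complex.add_re, re_trace_reducedState, re_trace_reducedState] at h
    refine h.trans (le_of_eq (Finset.sum_congr rfl fun i _ => ?_))
    rw [Matrix.mul_add, Matrix.add_mul, Matrix.add_apply, ← star_ancillaVec_dotProduct,
      ← star_ancillaVec_dotProduct, star_dotProduct_comm (ancillaVec U₁ u i),
      star_dotProduct_comm (ancillaVec U₁ v i), ← star_add, norm_star]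
  set G := ∑ i, g i
  have hGs : G ≤ s := hsumS ▸ Finset.sum_le_sum fun i _ => hgS i
  rw [ampliate_sub, Matrix.mul_sub, Matrix.trace_sub, trace_mul_ampliate_vecMulVec,
    trace_mul_ampliate_vecMulVec, ← Finset.sum_sub_distrib, Complex.re_sum]
  calc _ ≤ ∑ i, √(S i - g i) * √(S i + g i) :=
        Finset.sum_le_sum fun i _ => (hW.diagBlock i).re_sub_le _ _ _ _
    _ ≤ √(∑ i, (S i - g i)) * √(∑ i, (S i + g i)) :=
        Real.sum_sqrt_mul_sqrt_le _ (fun i => sub_nonneg.2 (hgS i))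
          fun i => add_nonneg ((hg0 i).trans (hgS i)) (hg0 i)
    _ = √((s - G) * (s + G)) := by
        rw [Finset.sum_sub_distrib, Finset.sum_add_distrib, hsumS, Real.sqrt_mul (by linarith)]
    _ ≤ √(s ^ 2 * (1 - m ^ 2)) := by
        refine Real.sqrt_le_sqrt ?_
        have : (m * s) ^ 2 ≤ G ^ 2 := pow_le_pow_left₀ (by positivity) hsumg 2
        nlinarith
    _ = s * √(1 - m ^ 2) := by rw [Real.sqrt_mul (sq_nonneg s), Real.sqrt_sq hs0]

theorem traceNorm_ampliate_le [Nonempty (Fin d)] (hm0 : 0 ≤ m)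
    (hU₁ : U₁ ∈ Matrix.unitaryGroup (Fin d) ℂ) (hU₂ : U₂ ∈ Matrix.unitaryGroup (Fin d) ℂ)
    (hm : ∀ ρ : Matrix (Fin d) (Fin d) ℂ, IsDensity ρ → m ≤ ∑ i, ‖(U₁ᴴ * ρ * U₂) i i‖)
    (X : Matrix (Fin d × Fin k) (Fin d × Fin k) ℂ) :
    traceNorm (ampliate (vnChannel U₁ - vnChannel U₂) k X) ≤ 2 * √(1 - m ^ 2) * traceNorm X := by
  obtain ⟨W, hW, hWX⟩ := exists_isContraction_trace_mul_eq
    (ampliate (vnChannel U₁ - vnChannel U₂) k X)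
  obtain ⟨u, v, hX, hu, hv⟩ := exists_eq_sum_vecMulVec X
  rw [← hWX]
  nth_rewrite 1 [hX]
  rw [ampliate_sum, Finset.mul_sum, Matrix.trace_sum, Complex.re_sum]
  calc _ ≤ ∑ j, (normSq (u j) + normSq (v j)) * √(1 - m ^ 2) := Finset.sum_le_sum fun j _ =>
        re_trace_mul_ampliate_vecMulVec_le hm0 hU₁ hU₂ hm hW _ _
    _ = _ := by rw [← Finset.sum_mul, Finset.sum_add_distrib, hu, hv]; ring

theorem le_traceNorm_ampliate_ketbra
    (hU₁ : U₁ ∈ Matrix.unitaryGroup (Fin d) ℂ) (hU₂ : U₂ ∈ Matrix.unitaryGroup (Fin d) ℂ)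
    {ψ : Fin d × Fin k → ℂ} (hψ : normSq ψ = 1)
    (h : ∀ i, ‖star (ancillaVec U₁ ψ i) ⬝ᵥ ancillaVec U₂ ψ i‖ =
        m * ((normSq (ancillaVec U₁ ψ i) + normSq (ancillaVec U₂ ψ i)) / 2) ∧
      (normSq (ancillaVec U₁ ψ i) = normSq (ancillaVec U₂ ψ i) ∨
        star (ancillaVec U₁ ψ i) ⬝ᵥ ancillaVec U₂ ψ i = 0)) :
    2 * √(1 - m ^ 2) ≤ traceNorm (ampliate (vnChannel U₁ - vnChannel U₂) k (ketbra ψ)) := by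
  -- The sign operators of the blocks assemble to one contraction. Proportional overlaps make each
  -- block contribute its weight times the same factor `√(1 - m ^ 2)`, so nothing is lost in the
  -- sum.
  choose W hW hWi using fun i => exists_isContraction_sqrt_le (h i).2
  refine le_trans ?_ (re_trace_mul_le_traceNorm (isContraction_labelSum hW) _)
  rw [ketbra, ampliate_sub, Matrix.mul_sub, Matrix.trace_sub, trace_mul_ampliate_vecMulVec,
    trace_mul_ampliate_vecMulVec, ← Finset.sum_sub_distrib, Complex.re_sum]
  simp only [diagBlock_labelSum]
  refine le_trans (le_of_eq ?_) (Finset.sum_le_sum fun i _ => hWi i)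
  have h1 (i : Fin d) : √((normSq (ancillaVec U₁ ψ i) + normSq (ancillaVec U₂ ψ i)) ^ 2 -
      4 * ‖star (ancillaVec U₁ ψ i) ⬝ᵥ ancillaVec U₂ ψ i‖ ^ 2) =
      (normSq (ancillaVec U₁ ψ i) + normSq (ancillaVec U₂ ψ i)) * √(1 - m ^ 2) := by
    rw [(h i).1, ← Real.sqrt_sq (add_nonneg (normSq_nonneg (ancillaVec U₁ ψ i))
      (normSq_nonneg (ancillaVec U₂ ψ i))), ← Real.sqrt_mul (sq_nonneg _),
      Real.sqrt_sq (add_nonneg (normSq_nonneg _) (normSq_nonneg _))]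
    congr 1
    ring
  simp only [h1]
  rw [← Finset.sum_mul, Finset.sum_add_distrib, sum_normSq_ancillaVec hU₁,
    sum_normSq_ancillaVec hU₂, hψ]
  norm_num

end diamond

/-! ### A common optimal input and the theorem -/

section main

variable {d : ℕ}

/-- The value of the minimization, together with an input vector that is optimal both for
unambiguous discrimination and for the diamond norm. -/
theorem exists_optimal_input [Nonempty (Fin d)] {U₁ U₂ : Matrix (Fin d) (Fin d) ℂ}
    (hU₁ : U₁ ∈ Matrix.unitaryGroup (Fin d) ℂ) (hU₂ : U₂ ∈ Matrix.unitaryGroup (Fin d) ℂ) :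
    ∃ m : ℝ, 0 ≤ m ∧ m ≤ 1 ∧
      IsLeast {r : ℝ | ∃ ρ : Matrix (Fin d) (Fin d) ℂ,
        IsDensity ρ ∧ r = ∑ i, ‖(U₁ᴴ * ρ * U₂) i i‖} m ∧
      IsGreatest (⋃ k, entUnambValues (vnChannel U₁) (vnChannel U₂) k) (1 - m) ∧
      IsGreatest (diamondValues (vnChannel U₁ - vnChannel U₂)) (2 * √(1 - m ^ 2)) ∧
      ∃ (ψ : Fin d × Fin d → ℂ) (T : Fin d → Fin 3 → Matrix (Fin d) (Fin d) ℂ),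
        star ψ ⬝ᵥ ψ = 1 ∧
        (∀ i, IsOptimalUnambiguous (ketbra (ancillaVec U₁ ψ i)) (ketbra (ancillaVec U₂ ψ i))
          (T i)) ∧
        successProb (ampliate (vnChannel U₁) d (ketbra ψ)) (ampliate (vnChannel U₂) d (ketbra ψ))
          (labelMeasurement T) = 1 - m := by
  obtain ⟨ρ, m, hρ, hm0, hm1, hm, hmin, hbal⟩ := exists_balanced_minimizer_pair hU₁ hU₂
  obtain ⟨ψ, hψ, rfl⟩ := exists_reducedState_eq hρ
  have hψ' : normSq ψ = 1 := by rw [normSq_eq_re, hψ, Complex.one_re]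
  simp only [← normSq_ancillaVec] at hbal
  choose T hT using fun i =>
    exists_isOptimalUnambiguous (ketbra (ancillaVec U₁ ψ i)) (ketbra (ancillaVec U₂ ψ i))
  have hopt := (labelMeasurement_isOptimalUnambiguous hT).1
  -- Balance gives this: either both squared norms agree and the overlap is `m ≤ 1` times them, or
  -- the overlap is zero.
  have hle : ∀ i, ‖(U₁ᴴ * reducedState ψ * U₂) i i‖ ≤ normSq (ancillaVec U₁ ψ i) ∧
      ‖(U₁ᴴ * reducedState ψ * U₂) i i‖ ≤ normSq (ancillaVec U₂ ψ i) := fun i => by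
    have h1 := normSq_nonneg (ancillaVec U₁ ψ i)
    have h2 := normSq_nonneg (ancillaVec U₂ ψ i)
    obtain ⟨h3, h4 | h4⟩ := hbal i
    · rw [h3, h4]
      constructor <;> nlinarith
    · rw [h4, norm_zero]
      exact ⟨h1, h2⟩
  have hs : successProb (ampliate (vnChannel U₁) d (ketbra ψ))
      (ampliate (vnChannel U₂) d (ketbra ψ)) (labelMeasurement T) = 1 - m :=
    le_antisymm (successProb_le_of_isUnambiguous hU₁ hU₂ hmin (ketbra_isDensity hψ) hopt)
      (le_successProb_labelMeasurement hU₁ hU₂ hψ' hm hle hT)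
  refine ⟨m, hm0, hm1, ⟨⟨_, hρ, hm.symm⟩, ?_⟩, ⟨?_, ?_⟩, ⟨?_, ?_⟩, ψ, T, hψ, hT, hs⟩
  · rintro _ ⟨σ, hσ, rfl⟩
    exact hmin σ hσ
  · exact Set.mem_iUnion.2 ⟨d, ketbra ψ, labelMeasurement T, ketbra_isDensity hψ, hopt, hs.symm⟩
  · rintro r hr
    obtain ⟨k, σ, M, hσ, hM, rfl⟩ := Set.mem_iUnion.1 hr
    exact successProb_le_of_isUnambiguous hU₁ hU₂ hmin hσ hM
  · refine ⟨d, ketbra ψ, traceNorm_ketbra hψ, le_antisymm ?_ ?_⟩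
    · refine le_traceNorm_ampliate_ketbra hU₁ hU₂ hψ' fun i => ?_
      rw [← norm_eq_zero (a := star (ancillaVec U₁ ψ i) ⬝ᵥ ancillaVec U₂ ψ i),
        norm_star_ancillaVec_dotProduct, norm_eq_zero]
      exact hbal i
    · have := traceNorm_ampliate_le hm0 hU₁ hU₂ hmin (ketbra ψ)
      rwa [traceNorm_ketbra hψ, mul_one] at this
  · rintro _ ⟨k, X, hX, rfl⟩
    have := traceNorm_ampliate_le hm0 hU₁ hU₂ hmin X
    rwa [hX, mul_one] at this

end main

theorem mainTheorem3 (d : ℕ) (hd : 0 < d) :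
    -- the relation with the diamond norm, for any two von Neumann measurements
    (∀ U₁ ∈ Matrix.unitaryGroup (Fin d) ℂ, ∀ U₂ ∈ Matrix.unitaryGroup (Fin d) ℂ,
      IsGreatest (⋃ k, entUnambValues (vnChannel U₁) (vnChannel U₂) k)
        (entUnambProb (vnChannel U₁) (vnChannel U₂)) ∧
      IsGreatest (diamondValues (vnChannel U₁ - vnChannel U₂))
        (diamondNorm (vnChannel U₁ - vnChannel U₂)) ∧
      diamondNorm (vnChannel U₁ - vnChannel U₂) ≤ 2 ∧
      entUnambProb (vnChannel U₁) (vnChannel U₂) =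
        1 - Real.sqrt (1 - diamondNorm (vnChannel U₁ - vnChannel U₂) ^ 2 / 4)) ∧
    (∀ U ∈ Matrix.unitaryGroup (Fin d) ℂ,
      -- the value of the optimal probability for the computational basis and `U`
      (∃ m : ℝ,
        IsLeast {r : ℝ | ∃ ρ : Matrix (Fin d) (Fin d) ℂ,
          IsDensity ρ ∧ r = ∑ i, ‖(ρ * U) i i‖} m ∧
        entUnambProb (vnChannel 1) (vnChannel U) = 1 - m) ∧
      -- for every pure input, reading the label and then optimally discriminating the pure
      -- states left on the ancilla is optimal
      (∀ (k : ℕ) (ψ : Fin d × Fin k → ℂ), star ψ ⬝ᵥ ψ = 1 →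
        ampliate (vnChannel 1) k (ketbra ψ) =
          ∑ i, Matrix.single i i (1 : ℂ) ⊗ₖ ketbra (ancillaVec 1 ψ i) ∧
        ampliate (vnChannel U) k (ketbra ψ) =
          ∑ i, Matrix.single i i (1 : ℂ) ⊗ₖ ketbra (ancillaVec U ψ i) ∧
        (∃ T : Fin d → Fin 3 → Matrix (Fin k) (Fin k) ℂ, ∀ i,
          IsOptimalUnambiguous (ketbra (ancillaVec 1 ψ i)) (ketbra (ancillaVec U ψ i)) (T i)) ∧
        ∀ T : Fin d → Fin 3 → Matrix (Fin k) (Fin k) ℂ,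
          (∀ i, IsOptimalUnambiguous (ketbra (ancillaVec 1 ψ i)) (ketbra (ancillaVec U ψ i))
            (T i)) →
          IsOptimalUnambiguous (ampliate (vnChannel 1) k (ketbra ψ))
            (ampliate (vnChannel U) k (ketbra ψ)) (labelMeasurement T)) ∧
      -- such a scheme, with an ancilla of dimension `d`, attains the optimal probability
      (∃ (ψ : Fin d × Fin d → ℂ) (T : Fin d → Fin 3 → Matrix (Fin d) (Fin d) ℂ),
        star ψ ⬝ᵥ ψ = 1 ∧
        (∀ i, IsOptimalUnambiguous (ketbra (ancillaVec 1 ψ i)) (ketbra (ancillaVec U ψ i))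
          (T i)) ∧
        successProb (ampliate (vnChannel 1) d (ketbra ψ)) (ampliate (vnChannel U) d (ketbra ψ))
          (labelMeasurement T) = entUnambProb (vnChannel 1) (vnChannel U))) := by
  have : Nonempty (Fin d) := ⟨⟨0, hd⟩⟩
  refine ⟨fun U₁ hU₁ U₂ hU₂ => ?_, fun U hU => ⟨?_, fun k ψ _ => ⟨?_, ?_, ?_, ?_⟩, ?_⟩⟩
  · obtain ⟨m, hm0, hm1, -, hp, hD, -⟩ := exists_optimal_input hU₁ hU₂
    have hp' : entUnambProb (vnChannel U₁) (vnChannel U₂) = 1 - m := hp.csSup_eq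
    have hD' : diamondNorm (vnChannel U₁ - vnChannel U₂) = 2 * √(1 - m ^ 2) := hD.csSup_eq
    have hs : 0 ≤ 1 - m ^ 2 := by nlinarith
    rw [hp', hD']
    refine ⟨hp, hD, ?_, ?_⟩
    · have : √(1 - m ^ 2) ≤ 1 := Real.sqrt_le_one.2 (by nlinarith)
      linarith
    · have : 1 - (2 * √(1 - m ^ 2)) ^ 2 / 4 = m ^ 2 := by
        rw [mul_pow, Real.sq_sqrt hs]
        ring
      rw [this, Real.sqrt_sq hm0]
  · obtain ⟨m, -, -, hm, hp, -⟩ := exists_optimal_input (one_mem _) hU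
    refine ⟨m, ?_, hp.csSup_eq⟩
    simpa only [Matrix.conjTranspose_one, one_mul] using hm
  · exact ampliate_vnChannel_ketbra 1 ψ
  · exact ampliate_vnChannel_ketbra U ψ
  · exact ⟨_, fun i => (exists_isOptimalUnambiguous _ _).choose_spec⟩
  · exact fun T hT => labelMeasurement_isOptimalUnambiguous hT
  · obtain ⟨m, -, -, -, hp, -, ψ, T, hψ, hT, hs⟩ := exists_optimal_input (one_mem _) hU
    exact ⟨ψ, T, hψ, hT, hs.trans hp.csSup_eq.symm⟩
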